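/- Let $n\ge 2$ and write $\xi=(\xi',\xi_n)\in\mathbb R^{n-1}\times\mathbb R$. Let $\psi:\mathbb R\to[0,\infty)$ be a smooth function supported in $[\tfrac14,1]$ with $\sum_{\gamma\in\mathbb Z}\psi(2^\gamma s)=1$ for all $s>0$. For $\lambda>0$ put $$m^\lambda(\xi)=\Big(1-\frac{|\xi'|^2}{\xi_n^2}\Big)_+^\lambda\,\psi(2^{-1}\xi_n),$$ and for a Schwartz function $f\in\mathcal S(\mathbb R^n)$ and $t>0$ put $$T_t^\lambda f(x)=\int_{\mathbb R^n}m^\lambda(t^{-1}\xi',\xi_n)\,\widehat f(\xi)\,e^{2\pi i x\cdot\xi}\,d\xi,\qquad T_*^\lambda f(x)=\sup_{t>0}|T_t^\lambda f(x)|,$$ where $\widehat f(\xi)=\int_{\mathbb R^n} f(x)e^{-2\pi i x\cdot\xi}\,dx$. **Proposition.** If $\lambda>\tfrac n2$ and $1<p<\infty$, then $T_*^\lambda$ is bounded on $L^p(\mathbb R^n)$: there is a constant $C<\infty$, depending only on $n,\lambda,p,\psi$, such that $$\|T_*^\lambda f\|_{L^p(\mathbb R^n)}\le C\|f\|_{L^p(\mathbb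 R^n)}$$ for every $f\in\mathcal S(\mathbb R^n)$. With the same $C$ the inequality holds for every $f\in L^p(\mathbb R^n)$, where for such $f$ one puts $T_t^\lambda f=K_t*f$ with $K_t(x)=\int_{\mathbb R^n}m^\lambda(t^{-1}\xi',\xi_n)e^{2\pi i x\cdot\xi}\,d\xi$; the integral defining $(K_t*f)(x)$ converges absolutely for all $t>0$ and all $x\in\mathbb R^n$. -/

import Mathlib

open MeasureTheory Set
open scoped FourierTransform SchwartzMap ENNReal NNReal ContDiff Convolution

noncomputable section

namespace ConeMultiplier

/-- The Euclidean space of dimension `n = d + 1`, whose points are written `(x', x_n)` with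
`x'` the first `d = n - 1` coordinates and `x_n` the last one. -/
abbrev Space (d : ℕ) : Type := EuclideanSpace ℝ (Fin (d + 1))

/-- The first `n - 1` coordinates `x'` of `x = (x', x_n)`. -/
def horiz {d : ℕ} (x : Space d) : EuclideanSpace ℝ (Fin d) :=
  WithLp.toLp 2 (fun i : Fin d => x i.castSucc)

/-- The last coordinate `x_n` of `x = (x', x_n)`. -/
def vert {d : ℕ} (x : Space d) : ℝ := x (Fin.last d)

/-- A nonnegative smooth function on the line, supported in `[1/4, 1]`, whose dyadic dilates form
a partition of unity on `(0, ∞)`. -/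
structure IsDyadicBump (ψ : ℝ → ℝ) : Prop where
  smooth : ContDiff ℝ ∞ ψ
  nonneg : ∀ s, 0 ≤ ψ s
  support_subset : tsupport ψ ⊆ Icc (1 / 4) 1
  partition : ∀ s, 0 < s → HasSum (fun γ : ℤ => ψ ((2 : ℝ) ^ γ * s)) 1

/-- The localized cone multiplier, as a function of the pair `(ξ', ξ_n)`:
`m^λ(ξ', ξ_n) = (1 - |ξ'|² / ξ_n²)_+^λ ψ(ξ_n / 2)`. -/
def symbol (ψ : ℝ → ℝ) (lam : ℝ) {d : ℕ} (ξ' : EuclideanSpace ℝ (Fin d)) (ξn : ℝ) : ℝ :=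
  (max (1 - ‖ξ'‖ ^ 2 / ξn ^ 2) 0) ^ lam * ψ (2⁻¹ * ξn)

/-- The anisotropically dilated multiplier `ξ ↦ m^λ(t⁻¹ ξ', ξ_n)`. -/
def dilatedSymbol (ψ : ℝ → ℝ) (lam : ℝ) {d : ℕ} (t : ℝ) (ξ : Space d) : ℝ :=
  symbol ψ lam (t⁻¹ • horiz ξ) (vert ξ)

/-- The cone means of a Schwartz function:
`T_t^λ f(x) = ∫ m^λ(t⁻¹ ξ', ξ_n) f̂(ξ) e^{2πi x·ξ} dξ`. -/
def coneMean (ψ : ℝ → ℝ) (lam : ℝ) {d : ℕ} (t : ℝ) (f : 𝓢(Space d, ℂ)) (x : Space d) : ℂ :=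
  𝓕⁻ (fun ξ : Space d => (dilatedSymbol ψ lam t ξ : ℂ) * 𝓕 (f : Space d → ℂ) ξ) x

/-- The maximal cone operator on Schwartz functions: `T_*^λ f(x) = sup_{t > 0} |T_t^λ f(x)|`. -/
def coneMaximal (ψ : ℝ → ℝ) (lam : ℝ) {d : ℕ} (f : 𝓢(Space d, ℂ)) (x : Space d) : ℝ≥0∞ :=
  ⨆ (t : ℝ) (_ : 0 < t), ‖coneMean ψ lam t f x‖ₑ

/-- The convolution kernel of `T_t^λ`: the inverse Fourier transform of `m^λ(t⁻¹ ξ', ξ_n)`. -/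
def coneKernel (ψ : ℝ → ℝ) (lam : ℝ) {d : ℕ} (t : ℝ) : Space d → ℂ :=
  𝓕⁻ (fun ξ : Space d => (dilatedSymbol ψ lam t ξ : ℂ))

/-- The maximal cone operator on general functions, where `T_t^λ` acts by convolution with its
kernel: `sup_{t > 0} |(K_t * f)(x)|`. -/
def coneMaximalConv (ψ : ℝ → ℝ) (lam : ℝ) {d : ℕ} (f : Space d → ℂ) (x : Space d) : ℝ≥0∞ :=
  ⨆ (t : ℝ) (_ : 0 < t),
    ‖(coneKernel ψ lam t ⋆[ContinuousLinearMap.mul ℂ ℂ, volume] f) x‖ₑ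

end ConeMultiplier

end

namespace ConeMultiplier

open Metric Module

/-! ### Marcinkiewicz interpolation through the layer-cake formula. -/

section Marcinkiewicz

/-! The maximal operator is dominated pointwise by a Hardy–Littlewood maximal function in `x'`
composed with an average in `x_n` against a finite measure. This rests on a kernel bound, uniform in
`t`, by `t^(n-1) (1 + t|x'|)^(-β) (1 + |x_n|)^(-γ)` with `β > n - 1` and `γ > 1`.

At height `v` the multiplier is a Bochner–Riesz profile on the ball of radius `tv`. Its inverse
Fourier transform is a one-dimensional integral with weight `(1 - u²)^a`, where `a = λ + (n-2)/2`.
Integrating in `v` first (`coneKernel_eq`) turns the kernel into `c t^(n-1) ∫ (1 - u²)^a Φ(t|x'|u +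
x_n) du`, with `Φ` the inverse transform of `ψ(v/2) v^(n-1)`. That function vanishes near `v = 0`,
so `Φ` has Schwartz primitives of every order. Integrating by parts until the exponent is
nonpositive gives decay `r^(-a-1)` in `r = t|x'|`, while for `|x_n| ≥ 2r` the decay of `Φ` itself
suffices (`exists_norm_sphericalAverage_le_mul`). The total decay `a + 1` can be shared between `β`
and `γ` exactly when `a + 1 > n`, that is `λ > n/2`. -/

theorem lintegral_ite_lt_rpow {p : ℝ} (hp : 0 < p) (X : ℝ≥0∞) :
    ∫⁻ s in Ioi (0 : ℝ), (if ENNReal.ofReal s < X then ENNReal.ofReal (s ^ (p - 1)) else 0)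
      = ENNReal.ofReal p⁻¹ * X ^ p := by
  have key : ∀ Y : ℝ≥0,
      ∫⁻ s in Ioi (0 : ℝ), (if ENNReal.ofReal s < Y then ENNReal.ofReal (s ^ (p - 1)) else 0)
        = ENNReal.ofReal p⁻¹ * (Y : ℝ≥0∞) ^ p := by
    intro Y
    -- The layer-cake formula for the constant `Y` on a one-point space.
    have h := lintegral_rpow_eq_lintegral_meas_lt_mul (Measure.dirac ())
      (f := fun _ => (Y : ℝ)) (Filter.Eventually.of_forall fun _ => Y.coe_nonneg) aemeasurable_const hp
    simp only [lintegral_dirac] at h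
    have h2 : ∫⁻ s in Ioi (0 : ℝ),
          (if ENNReal.ofReal s < Y then ENNReal.ofReal (s ^ (p - 1)) else 0)
        = ∫⁻ t in Ioi (0 : ℝ), Measure.dirac () {_a : Unit | t < (Y : ℝ)}
            * ENNReal.ofReal (t ^ (p - 1)) := by
      refine setLIntegral_congr_fun measurableSet_Ioi fun t ht => ?_
      have : ENNReal.ofReal t < Y ↔ t < Y := by
        rw [ENNReal.ofReal_lt_coe_iff (le_of_lt ht)]
      by_cases hY : t < Y <;> simp [this, hY]
    rw [← ENNReal.ofReal_rpow_of_nonneg Y.coe_nonneg hp.le, ENNReal.ofReal_coe_nnreal] at h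
    rw [h2, ENNReal.ofReal_inv_of_pos hp, h, ← mul_assoc, ENNReal.inv_mul_cancel (by simpa using hp) ENNReal.ofReal_ne_top, one_mul]
  induction X with
  | coe Y => exact key Y
  | top =>
    rw [ENNReal.top_rpow_of_pos hp, ENNReal.mul_top (by simpa using hp)]
    -- The finite level `(p r)^(1/p)` gives the value `r` exactly, so by monotonicity the integral
    -- at `⊤` exceeds every `r`.
    refine ENNReal.eq_top_of_forall_nnreal_le fun r => ?_
    have hr : (r : ℝ≥0∞) = ENNReal.ofReal p⁻¹ * (((p.toNNReal * r) ^ p⁻¹ : ℝ≥0) : ℝ≥0∞) ^ p := by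
      rw [← ENNReal.coe_rpow_of_nonneg _ hp.le, ← NNReal.rpow_mul, inv_mul_cancel₀ hp.ne',
        NNReal.rpow_one, ENNReal.coe_mul, ← mul_assoc, ENNReal.ofReal_inv_of_pos hp]
      change _ = (ENNReal.ofReal p)⁻¹ * ENNReal.ofReal p * r
      rw [ENNReal.inv_mul_cancel (by simpa using hp) ENNReal.ofReal_ne_top, one_mul]
    rw [hr, ← key]
    refine lintegral_mono fun s => ?_
    by_cases h : ENNReal.ofReal s < (((p.toNNReal * r) ^ p⁻¹ : ℝ≥0) : ℝ≥0∞)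
    · simp [h]
    · simp [h]

variable {α : Type*} [MeasurableSpace α] {μ : Measure α} [SFinite μ]

/-- The diagonal case of the Marcinkiewicz interpolation theorem, between a restricted weak-type
`(1, 1)` bound and a trivial bound at infinity. -/
theorem lintegral_rpow_le_of_weakType {F g : α → ℝ≥0∞} (hF : Measurable F) (hg : Measurable g)
    {A : ℝ≥0∞} (hA : A ≠ ⊤) {p : ℝ} (hp : 1 < p)
    (h : ∀ s : ℝ, 0 < s → μ {x | ENNReal.ofReal s < F x}
      ≤ A * (ENNReal.ofReal s)⁻¹ * ∫⁻ x in {x | ENNReal.ofReal s < 2 * g x}, g x ∂μ) :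
    ∫⁻ x, F x ^ p ∂μ
      ≤ A * ENNReal.ofReal (p * (p - 1)⁻¹ * 2 ^ (p - 1)) * ∫⁻ x, g x ^ p ∂μ := by
  have hp0 : 0 < p := by linarith
  have hp1 : 0 < p - 1 := by linarith
  have hpow : ∀ q : ℝ, Measurable fun s : ℝ => ENNReal.ofReal (s ^ q) := fun q => by fun_prop
  have meas : ∀ (q : ℝ) (G : α → ℝ≥0∞), Measurable G → Measurable fun z : ℝ × α =>
      (if ENNReal.ofReal z.1 < G z.2 then ENNReal.ofReal (z.1 ^ q) else 0) := fun q G hG =>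
    Measurable.ite (measurableSet_lt (by fun_prop) (by fun_prop))
      ((hpow q).comp measurable_fst) measurable_const
  have e1 : ∫⁻ x, F x ^ p ∂μ = ENNReal.ofReal p * ∫⁻ s in Ioi (0 : ℝ),
      ENNReal.ofReal (s ^ (p - 1)) * μ {x | ENNReal.ofReal s < F x} := by
    have : ∀ x, F x ^ p = ENNReal.ofReal p * ∫⁻ s in Ioi (0 : ℝ),
        (if ENNReal.ofReal s < F x then ENNReal.ofReal (s ^ (p - 1)) else 0) := fun x => by
      rw [lintegral_ite_lt_rpow hp0, ← mul_assoc, ← ENNReal.ofReal_mul hp0.le,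
        mul_inv_cancel₀ hp0.ne', ENNReal.ofReal_one, one_mul]
    simp_rw [this]
    rw [lintegral_const_mul' _ _ ENNReal.ofReal_ne_top, lintegral_lintegral_swap]
    · congr 1
      refine lintegral_congr fun s => ?_
      rw [← lintegral_indicator_const (measurableSet_lt measurable_const hF)]
      exact lintegral_congr fun x => by simp [indicator]
    · exact ((meas (p - 1) F hF).comp measurable_swap).aemeasurable
  -- The factor `s⁻¹` of the weak-type bound lowers the exponent to `p - 2`. After Tonelli the inner
  -- integral is `(2g)^(p-1) / (p-1)`, finite at finite `g` because `p > 1`.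
  have e2 : ∫⁻ s in Ioi (0 : ℝ), (ENNReal.ofReal (s ^ (p - 1 - 1)) *
      ∫⁻ x in {x | ENNReal.ofReal s < 2 * g x}, g x ∂μ)
      = ENNReal.ofReal (p - 1)⁻¹ * 2 ^ (p - 1) * ∫⁻ x, g x ^ p ∂μ := by
    have : ∀ s : ℝ, (ENNReal.ofReal (s ^ (p - 1 - 1)) *
        ∫⁻ x in {x | ENNReal.ofReal s < 2 * g x}, g x ∂μ)
        = ∫⁻ x, g x *
          (if ENNReal.ofReal s < 2 * g x then ENNReal.ofReal (s ^ (p - 1 - 1)) else 0) ∂μ := by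
      intro s
      rw [← lintegral_indicator (measurableSet_lt measurable_const (by fun_prop)),
        ← lintegral_const_mul' _ _ ENNReal.ofReal_ne_top]
      refine lintegral_congr fun x => ?_
      by_cases hx : ENNReal.ofReal s < 2 * g x <;> simp [indicator, mul_comm]
    simp_rw [this]
    rw [lintegral_lintegral_swap, ← lintegral_const_mul _ (by fun_prop)]
    · refine lintegral_congr fun x => ?_
      rw [lintegral_const_mul, lintegral_ite_lt_rpow hp1, ENNReal.mul_rpow_of_nonneg _ _ hp1.le]
      · have : g x ^ p = g x * g x ^ (p - 1) := by
          conv_rhs => enter [1]; rw [← ENNReal.rpow_one (g x)]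
          rw [← ENNReal.rpow_add_of_nonneg _ _ zero_le_one hp1.le]; congr 1; ring
        rw [this]; ring
      · exact (meas (p - 1 - 1) (fun x => 2 * g x) (by fun_prop)).comp measurable_prodMk_right
    · exact ((hg.comp measurable_snd).mul
        (meas (p - 1 - 1) (fun x => 2 * g x) (by fun_prop))).aemeasurable
  rw [e1]
  calc ENNReal.ofReal p * ∫⁻ s in Ioi (0 : ℝ),
        ENNReal.ofReal (s ^ (p - 1)) * μ {x | ENNReal.ofReal s < F x}
      ≤ ENNReal.ofReal p * ∫⁻ s in Ioi (0 : ℝ), A * (ENNReal.ofReal (s ^ (p - 1 - 1)) *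
          ∫⁻ x in {x | ENNReal.ofReal s < 2 * g x}, g x ∂μ) := by
        gcongr ENNReal.ofReal p * ?_
        refine setLIntegral_mono' measurableSet_Ioi fun s hs => ?_
        have hs : 0 < s := hs
        calc _ ≤ ENNReal.ofReal (s ^ (p - 1)) * (A * (ENNReal.ofReal s)⁻¹ *
              ∫⁻ x in {x | ENNReal.ofReal s < 2 * g x}, g x ∂μ) := by gcongr; exact h s hs
          _ = _ := by
            rw [Real.rpow_sub_one hs.ne' (p - 1), div_eq_mul_inv,
              ENNReal.ofReal_mul (by positivity), ENNReal.ofReal_inv_of_pos hs]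
            ring
    _ = _ := by
        rw [lintegral_const_mul' _ _ hA, e2, ENNReal.ofReal_mul (by positivity),
          ENNReal.ofReal_mul hp0.le, ← ENNReal.ofReal_rpow_of_pos two_pos]
        simp only [ENNReal.ofReal_ofNat]
        ring

end Marcinkiewicz

/-! ### The Hardy–Littlewood maximal theorem for dyadic radii. -/

section Maximal

variable {E : Type*} [NormedAddCommGroup E] [MeasurableSpace E] (μ : Measure E)

/-- The centred Hardy–Littlewood maximal function over dyadic radii. -/
noncomputable def dyadicMaximal (g : E → ℝ≥0∞) (x : E) : ℝ≥0∞ :=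
  ⨆ k : ℤ, (μ (closedBall x (2 ^ k)))⁻¹ * ∫⁻ y in closedBall x (2 ^ k), g y ∂μ

variable [NormedSpace ℝ E] [FiniteDimensional ℝ E] [BorelSpace E] [μ.IsAddHaarMeasure]

/-- Weak type `(1, 1)` by Vitali covering: disjoint balls with large averages cover the level set
once enlarged four times, whence `4 ^ finrank`. The covering theorem needs bounded radii, so they
are first capped at `2 ^ K` and then `K → ∞`. -/
theorem measure_lt_dyadicMaximal_le (g : E → ℝ≥0∞) {a : ℝ≥0∞} (ha : a ≠ 0) (ha' : a ≠ ⊤) :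
    μ {x | a < dyadicMaximal μ g x}
      ≤ ENNReal.ofReal (4 ^ finrank ℝ E) * a⁻¹ * ∫⁻ x, g x ∂μ := by
  have trunc : ∀ K : ℕ, μ {x | ∃ k : ℤ, k ≤ K ∧
      a < (μ (closedBall x (2 ^ k)))⁻¹ * ∫⁻ y in closedBall x (2 ^ k), g y ∂μ}
        ≤ ENNReal.ofReal (4 ^ finrank ℝ E) * a⁻¹ * ∫⁻ x, g x ∂μ := by
    intro K
    set S := {x | ∃ k : ℤ, k ≤ K ∧
      a < (μ (closedBall x (2 ^ k)))⁻¹ * ∫⁻ y in closedBall x (2 ^ k), g y ∂μ}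
    choose! k hkK hk using fun x (hx : x ∈ S) => hx
    obtain ⟨u, huS, hdisj, hcov⟩ := Vitali.exists_disjoint_subfamily_covering_enlargement_closedBall
      S id (fun x => (2 : ℝ) ^ k x) ((2 : ℝ) ^ (K : ℤ))
      (fun x hx => zpow_le_zpow_right₀ one_le_two (hkK x hx)) 4 (by norm_num)
    have hr : ∀ x, (0 : ℝ) < 2 ^ k x := fun x => by positivity
    have hu : u.Countable := hdisj.countable_of_nonempty_interior fun x _ =>
      ⟨x, ball_subset_interior_closedBall (mem_ball_self (hr x))⟩
    have : Countable u := hu.to_subtype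
    calc μ S ≤ μ (⋃ b ∈ u, closedBall b (4 * 2 ^ k b)) := by
          refine measure_mono fun x hx => ?_
          obtain ⟨b, hb, hb'⟩ := hcov x hx
          exact mem_iUnion₂.2 ⟨b, hb, hb' (mem_closedBall_self (hr x).le)⟩
      _ ≤ ∑' b : u, μ (closedBall (b : E) (4 * 2 ^ k b)) := measure_biUnion_le _ hu _
      _ ≤ ∑' b : u, ENNReal.ofReal (4 ^ finrank ℝ E) * a⁻¹ *
            ∫⁻ y in closedBall (b : E) (2 ^ k b), g y ∂μ := by
          refine ENNReal.tsum_le_tsum fun b => ?_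
          rw [Measure.addHaar_closedBall_mul μ _ (by norm_num : (0 : ℝ) ≤ 4) (hr b).le,
            mul_assoc, ← Measure.addHaar_closedBall_center μ (b : E)]
          gcongr
          have h1 := (hk b (huS b.2)).le
          have h0 : μ (closedBall (b : E) (2 ^ k b)) ≠ 0 :=
            (measure_closedBall_pos μ _ (hr b)).ne'
          have h2 : μ (closedBall (b : E) (2 ^ k b)) ≠ ⊤ := measure_closedBall_lt_top.ne
          rw [← ENNReal.div_eq_inv_mul, ENNReal.le_div_iff_mul_le (.inl ha) (.inl ha')]
          rw [← ENNReal.div_eq_inv_mul, ENNReal.le_div_iff_mul_le (.inl h0) (.inl h2)] at h1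
          rwa [mul_comm]
      _ = ENNReal.ofReal (4 ^ finrank ℝ E) * a⁻¹ *
            ∫⁻ y in ⋃ b ∈ u, closedBall b (2 ^ k b), g y ∂μ := by
          rw [ENNReal.tsum_mul_left]
          congr 1
          exact (lintegral_biUnion hu (fun _ _ => measurableSet_closedBall) hdisj g).symm
      _ ≤ _ := by gcongr; exact Measure.restrict_le_self
  have hU : {x | a < dyadicMaximal μ g x} = ⋃ K : ℕ, {x | ∃ k : ℤ, k ≤ K ∧
      a < (μ (closedBall x (2 ^ k)))⁻¹ * ∫⁻ y in closedBall x (2 ^ k), g y ∂μ} := by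
    ext x
    simp only [dyadicMaximal, lt_iSup_iff, mem_iUnion, mem_ofPred_eq]
    exact ⟨fun ⟨k, hk⟩ => ⟨k.toNat, k, Int.self_le_toNat k, hk⟩, fun ⟨_, k, _, hk⟩ => ⟨k, hk⟩⟩
  rw [hU, Monotone.measure_iUnion]
  · exact iSup_le trunc
  · intro K L hKL x ⟨k, hk, h⟩
    exact ⟨k, hk.trans (by exact_mod_cast hKL), h⟩

/-- The part of `g` below `s / 2` adds at most `s / 2` to any average, so only the part above it
must push the maximal function past `s / 2`. This is the form that interpolation consumes. -/
theorem measure_lt_dyadicMaximal_le_setLIntegral {g : E → ℝ≥0∞} (hg : Measurable g) {s : ℝ}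
    (hs : 0 < s) : μ {x | ENNReal.ofReal s < dyadicMaximal μ g x}
      ≤ ENNReal.ofReal (4 ^ finrank ℝ E) * 2 * (ENNReal.ofReal s)⁻¹ *
        ∫⁻ x in {x | ENNReal.ofReal s < 2 * g x}, g x ∂μ := by
  set a := ENNReal.ofReal (s / 2)
  have ha : a ≠ 0 := by simpa [a] using hs
  have ha' : a ≠ ⊤ := ENNReal.ofReal_ne_top
  have hs2 : ENNReal.ofReal s = 2 * a := by
    rw [← ENNReal.ofReal_ofNat 2, ← ENNReal.ofReal_mul two_pos.le]; congr 1; ring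
  set S := {x | ENNReal.ofReal s < 2 * g x}
  have hS : MeasurableSet S := measurableSet_lt measurable_const (by fun_prop)
  have hle : ∀ x, dyadicMaximal μ g x ≤ dyadicMaximal μ (S.indicator g) x + a := by
    intro x
    refine iSup_le fun k => ?_
    have h0 : μ (closedBall x (2 ^ k)) ≠ 0 := (measure_closedBall_pos μ _ (by positivity)).ne'
    have h2 : μ (closedBall x (2 ^ k)) ≠ ⊤ := measure_closedBall_lt_top.ne
    have hga : ∀ y, g y ≤ S.indicator g y + a := by
      intro y
      by_cases hy : y ∈ S
      · simp [hy]
      · rw [indicator_of_notMem hy, zero_add]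
        simp only [S, mem_ofPred_eq, not_lt, hs2] at hy
        exact (ENNReal.mul_le_mul_iff_right two_ne_zero ENNReal.ofNat_ne_top).1 hy
    calc _ ≤ (μ (closedBall x (2 ^ k)))⁻¹ *
          ∫⁻ y in closedBall x (2 ^ k), (S.indicator g y + a) ∂μ := by gcongr; exact hga _
      _ = (μ (closedBall x (2 ^ k)))⁻¹ * (∫⁻ y in closedBall x (2 ^ k), S.indicator g y ∂μ) + a := by
          rw [lintegral_add_right _ measurable_const, setLIntegral_const, mul_add, mul_comm a,
            ← mul_assoc, ENNReal.inv_mul_cancel h0 h2, one_mul]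
      _ ≤ _ := by
          gcongr
          exact le_iSup (fun k : ℤ => (μ (closedBall x (2 ^ k)))⁻¹ *
            ∫⁻ y in closedBall x (2 ^ k), S.indicator g y ∂μ) k
  calc μ {x | ENNReal.ofReal s < dyadicMaximal μ g x}
      ≤ μ {x | a < dyadicMaximal μ (S.indicator g) x} := by
        refine measure_mono fun x hx => ?_
        have := lt_of_lt_of_le hx (hle x)
        rw [hs2, two_mul] at this
        exact lt_of_add_lt_add_right this
    _ ≤ _ := measure_lt_dyadicMaximal_le μ _ ha ha'
    _ = _ := by
        rw [lintegral_indicator hS, hs2, ENNReal.mul_inv (.inl two_ne_zero)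
          (.inl ENNReal.ofNat_ne_top), mul_assoc _ 2, ← mul_assoc 2,
          ENNReal.mul_inv_cancel two_ne_zero ENNReal.ofNat_ne_top, one_mul]

theorem measurable_setLIntegral_closedBall {β : Type*} [MeasurableSpace β] {h : β × E → ℝ≥0∞}
    (hh : Measurable h) {c : β → E} (hc : Measurable c) (r : ℝ) :
    Measurable fun b => ∫⁻ y in closedBall (c b) r, h (b, y) ∂μ := by
  have : ∀ b, ∫⁻ y in closedBall (c b) r, h (b, y) ∂μ
      = ∫⁻ y, {z : β × E | dist z.2 (c z.1) ≤ r}.indicator h (b, y) ∂μ := fun b => by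
    rw [← lintegral_indicator measurableSet_closedBall]; rfl
  simp_rw [this]
  refine Measurable.lintegral_prod_right' (hh.indicator (measurableSet_le ?_ measurable_const))
  exact measurable_snd.dist (hc.comp measurable_fst)

/-- Joint measurability is needed for Tonelli when the maximal function acts on horizontal slices
with the height as parameter. -/
theorem measurable_dyadicMaximal_prod {β : Type*} [MeasurableSpace β] {h : β × E → ℝ≥0∞}
    (hh : Measurable h) :
    Measurable fun z : β × E => dyadicMaximal μ (fun y => h (z.1, y)) z.2 := by
  refine Measurable.iSup fun k => ?_
  have hc : ∀ z : β × E, μ (closedBall z.2 (2 ^ k)) = μ (closedBall 0 (2 ^ k)) := fun z =>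
    Measure.addHaar_closedBall_center μ _ _
  simp_rw [hc]
  refine Measurable.const_mul ?_ _
  exact measurable_setLIntegral_closedBall μ (β := β × E) (h := fun w => h (w.1.1, w.2))
    (by fun_prop) measurable_snd _

theorem measurable_dyadicMaximal {g : E → ℝ≥0∞} (hg : Measurable g) :
    Measurable (dyadicMaximal μ g) := by
  refine Measurable.iSup fun k => ?_
  simp_rw [fun z : E => Measure.addHaar_closedBall_center μ z (2 ^ k)]
  refine Measurable.const_mul ?_ _
  exact measurable_setLIntegral_closedBall μ (β := E) (h := fun w => g w.2)
    (hg.comp measurable_snd) measurable_id _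

/-- The Hardy–Littlewood maximal theorem. -/
theorem exists_lintegral_dyadicMaximal_rpow_le {p : ℝ} (hp : 1 < p) :
    ∃ C : ℝ≥0, ∀ g : E → ℝ≥0∞, Measurable g →
      ∫⁻ x, dyadicMaximal μ g x ^ p ∂μ ≤ C * ∫⁻ x, g x ^ p ∂μ := by
  refine ⟨(4 ^ finrank ℝ E * 2 * (p * (p - 1)⁻¹ * 2 ^ (p - 1))).toNNReal, fun g hg => ?_⟩
  refine (lintegral_rpow_le_of_weakType (measurable_dyadicMaximal μ hg) hg
    (ENNReal.mul_ne_top ENNReal.ofReal_ne_top ENNReal.ofNat_ne_top) hp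
    fun s hs => measure_lt_dyadicMaximal_le_setLIntegral μ hg hs).trans (le_of_eq ?_)
  congr 1
  rw [← ENNReal.ofReal_ofNat 2, ← ENNReal.ofReal_mul (by positivity),
    ← ENNReal.ofReal_mul (by positivity)]
  rfl

end Maximal

end ConeMultiplier

/-! ### Domination of dilated weights by the maximal function; averages in the last variable. -/

namespace ConeMultiplier

open Metric Module

/-- The least `k` with `r ≤ 2 ^ k` also satisfies `2 ^ k ≤ 2 (1 + r)`, so that single term already
dominates. The sum splits the weight into indicators of dyadic balls. -/
theorem ofReal_one_add_rpow_neg_le_tsum {β r : ℝ} (hβ : 0 ≤ β) (hr : 0 ≤ r) :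
    ENNReal.ofReal ((1 + r) ^ (-β)) ≤
      ∑' k : ℕ, ENNReal.ofReal ((2 ^ k / 2) ^ (-β)) * (Iic ((2 : ℝ) ^ k)).indicator 1 r := by
  have hex : ∃ k : ℕ, r ≤ 2 ^ k := by
    obtain ⟨k, hk⟩ := pow_unbounded_of_one_lt r one_lt_two
    exact ⟨k, hk.le⟩
  obtain ⟨k, hk, hk2⟩ : ∃ k : ℕ, r ≤ 2 ^ k ∧ (2 : ℝ) ^ k ≤ 2 * (1 + r) := by
    classical
    refine ⟨Nat.find hex, Nat.find_spec hex, ?_⟩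
    rcases h : Nat.find hex with _ | m
    · rw [pow_zero]; linarith
    · have := Nat.find_min hex (m := m) (by omega)
      rw [pow_succ]; linarith
  refine le_trans ?_ (ENNReal.le_tsum k)
  rw [indicator_of_mem (show r ∈ Iic ((2 : ℝ) ^ k) from hk), Pi.one_apply, mul_one]
  exact ENNReal.ofReal_le_ofReal
    (Real.rpow_le_rpow_of_nonpos (by positivity) (by linarith) (by linarith))

/-- Hölder against the constant `1` for the finite measure `ν`, followed by Tonelli and translation
invariance in the last variable. -/
theorem lintegral_rpow_lintegral_sub_le {E : Type*} [MeasurableSpace E] (μ : Measure E)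
    [SFinite μ] (ν : Measure ℝ) [IsFiniteMeasure ν] {p : ℝ} (hp : 1 < p)
    {f : E × ℝ → ℝ≥0∞} (hf : Measurable f) :
    ∫⁻ z, (∫⁻ v, f (z.1, z.2 - v) ∂ν) ^ p ∂(μ.prod volume)
      ≤ ν univ ^ p * ∫⁻ z, f z ^ p ∂(μ.prod volume) := by
  have hp0 : 0 < p := by linarith
  have hpq := Real.HolderConjugate.conjExponent hp
  set q := p.conjExponent
  have hfm : Measurable fun w : (E × ℝ) × ℝ => f (w.1.1, w.1.2 - w.2) := hf.comp (by fun_prop)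
  have holder : ∀ z : E × ℝ, (∫⁻ v, f (z.1, z.2 - v) ∂ν) ^ p
      ≤ ν univ ^ (p - 1) * ∫⁻ v, f (z.1, z.2 - v) ^ p ∂ν := by
    intro z
    have h := ENNReal.lintegral_mul_le_Lp_mul_Lq ν hpq
      (f := fun v => f (z.1, z.2 - v)) (g := 1)
      (hf.comp (by fun_prop)).aemeasurable aemeasurable_const
    simp only [Pi.mul_apply, Pi.one_apply, mul_one, ENNReal.one_rpow, lintegral_one] at h
    calc _ ≤ ((∫⁻ v, f (z.1, z.2 - v) ^ p ∂ν) ^ (1 / p) * ν univ ^ (1 / q)) ^ p := by gcongr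
      _ = _ := by
        rw [ENNReal.mul_rpow_of_nonneg _ _ hp0.le, ← ENNReal.rpow_mul, ← ENNReal.rpow_mul,
          one_div_mul_cancel hp0.ne', ENNReal.rpow_one, mul_comm]
        congr 2
        rw [one_div, ← hpq.one_sub_inv]; field_simp
  calc _ ≤ ∫⁻ z, ν univ ^ (p - 1) * ∫⁻ v, f (z.1, z.2 - v) ^ p ∂ν ∂(μ.prod volume) :=
        lintegral_mono holder
    _ = ν univ ^ (p - 1) * ∫⁻ v, ∫⁻ z, f (z.1, z.2 - v) ^ p ∂(μ.prod volume) ∂ν := by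
        rw [lintegral_const_mul' _ _ (ENNReal.rpow_ne_top_of_nonneg (by linarith)
          (measure_ne_top _ _)), lintegral_lintegral_swap]
        exact (hfm.pow_const p).aemeasurable
    _ = ν univ ^ (p - 1) * ∫⁻ _v, (∫⁻ z, f z ^ p ∂(μ.prod volume)) ∂ν := by
        congr 1
        refine lintegral_congr fun v => ?_
        have hfv : Measurable fun z : E × ℝ => f (z.1, z.2 - v) := hf.comp (by fun_prop)
        rw [lintegral_prod _ (hfv.pow_const p).aemeasurable,
          lintegral_prod _ (hf.pow_const p).aemeasurable]
        exact lintegral_congr fun x => lintegral_sub_right_eq_self (fun s => f (x, s) ^ p) v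
    _ = _ := by
        rw [lintegral_const, mul_comm (lintegral _ _), ← mul_assoc]
        congr 1
        conv_lhs => enter [2]; rw [← ENNReal.rpow_one (ν univ)]
        rw [← ENNReal.rpow_add_of_nonneg _ _ (by linarith) zero_le_one]; congr 1; ring

section

variable {E : Type*} [NormedAddCommGroup E] [MeasurableSpace E] (μ : Measure E)
  [NormedSpace ℝ E] [FiniteDimensional ℝ E] [BorelSpace E] [μ.IsAddHaarMeasure]

theorem lintegral_indicator_norm_le_mul_comp_sub_le (g : E → ℝ≥0∞) (x : E) (k : ℤ) :
    ∫⁻ y, (Iic ((2 : ℝ) ^ k)).indicator 1 ‖y‖ * g (x - y) ∂μ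
      ≤ ENNReal.ofReal ((2 ^ k) ^ finrank ℝ E) * μ (closedBall 0 1) * dyadicMaximal μ g x := by
  have h0 : μ (closedBall x (2 ^ k)) ≠ 0 := (measure_closedBall_pos μ _ (by positivity)).ne'
  have h2 : μ (closedBall x (2 ^ k)) ≠ ⊤ := measure_closedBall_lt_top.ne
  have e : ∀ y, (Iic ((2 : ℝ) ^ k)).indicator 1 ‖y‖ * g (x - y)
      = (closedBall x ((2 : ℝ) ^ k)).indicator g (x - y) := by
    intro y
    by_cases hy : ‖y‖ ≤ 2 ^ k <;> simp [indicator, mem_closedBall, hy]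
  simp_rw [e]
  rw [lintegral_sub_left_eq_self (fun y => (closedBall x ((2 : ℝ) ^ k)).indicator g y) x,
    lintegral_indicator measurableSet_closedBall, ← Measure.addHaar_closedBall' μ x (by positivity)]
  calc _ = μ (closedBall x (2 ^ k)) *
        ((μ (closedBall x (2 ^ k)))⁻¹ * ∫⁻ y in closedBall x (2 ^ k), g y ∂μ) := by
        rw [← mul_assoc, ENNReal.mul_inv_cancel h0 h2, one_mul]
    _ ≤ _ := by
        gcongr
        exact le_iSup (fun k : ℤ => (μ (closedBall x (2 ^ k)))⁻¹ *
            ∫⁻ y in closedBall x (2 ^ k), g y ∂μ) k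

/-- Convolution with the dilates of an integrable radially decreasing weight is controlled by the
maximal function. -/
theorem exists_lintegral_dilate_le_dyadicMaximal {β : ℝ} (hβ : finrank ℝ E < β) :
    ∃ C : ℝ≥0, ∀ g : E → ℝ≥0∞, Measurable g → ∀ t : ℝ, 0 < t → ∀ x : E,
      ∫⁻ y, ENNReal.ofReal (t ^ finrank ℝ E * (1 + t * ‖y‖) ^ (-β)) * g (x - y) ∂μ
        ≤ C * dyadicMaximal μ g x := by
  set D := finrank ℝ E
  have hβ0 : 0 < β := lt_of_le_of_lt (Nat.cast_nonneg D) hβ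
  -- From one dyadic ball to the next the volume grows by `2 ^ D` and the weight shrinks by `2 ^
  -- (-β)`; their product is the ratio of a convergent series.
  set q : ℝ := 2 ^ ((D : ℝ) - β)
  have hq0 : 0 < q := by positivity
  have hq1 : q < 1 := Real.rpow_lt_one_of_one_lt_of_neg one_lt_two (by linarith)
  set c : ℝ := 2 ^ D * 2 ^ β
  have hsum : Summable fun k : ℕ => c * q ^ k :=
    (summable_geometric_of_lt_one hq0.le hq1).mul_left c
  have hfin : ENNReal.ofReal (∑' k : ℕ, c * q ^ k) * μ (closedBall 0 1) ≠ ⊤ :=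
    ENNReal.mul_ne_top ENNReal.ofReal_ne_top measure_closedBall_lt_top.ne
  refine ⟨(ENNReal.ofReal (∑' k : ℕ, c * q ^ k) * μ (closedBall 0 1)).toNNReal,
    fun g hg t ht x => ?_⟩
  rw [ENNReal.coe_toNNReal hfin, ENNReal.ofReal_tsum_of_nonneg (fun k => by positivity) hsum]
  -- Here `2 ^ n < t⁻¹ ≤ 2 ^ (n + 1)`: the upper bound puts `t‖y‖ ≤ 2 ^ k` inside a dyadic ball, and
  -- the lower one absorbs `t ^ D`. The rounding costs the `2 ^ D` in `c`; its `2 ^ β` comes from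
  -- the half in `2 ^ k / 2`.
  obtain ⟨n, hn1, hn2⟩ := exists_mem_Ioc_zpow (inv_pos.2 ht) (one_lt_two (α := ℝ))
  have htn : t * 2 ^ n ≤ 1 := by
    rw [mul_comm]; exact (mul_le_mul_of_nonneg_right hn1.le ht.le).trans_eq (inv_mul_cancel₀ ht.ne')
  calc ∫⁻ y, ENNReal.ofReal (t ^ D * (1 + t * ‖y‖) ^ (-β)) * g (x - y) ∂μ
      ≤ ∫⁻ y, ∑' k : ℕ, ENNReal.ofReal (t ^ D * (2 ^ k / 2) ^ (-β)) *
          ((Iic ((2 : ℝ) ^ (k + (n + 1)))).indicator 1 ‖y‖ * g (x - y)) ∂μ := by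
        refine lintegral_mono fun y => ?_
        rw [ENNReal.ofReal_mul (by positivity)]
        calc _ ≤ ENNReal.ofReal (t ^ D) * (∑' k : ℕ, ENNReal.ofReal ((2 ^ k / 2) ^ (-β)) *
              (Iic ((2 : ℝ) ^ k)).indicator 1 (t * ‖y‖)) * g (x - y) := by
              gcongr
              exact ofReal_one_add_rpow_neg_le_tsum hβ0.le (by positivity)
          _ = ∑' k : ℕ, ENNReal.ofReal (t ^ D * (2 ^ k / 2) ^ (-β)) *
              ((Iic ((2 : ℝ) ^ k)).indicator 1 (t * ‖y‖) * g (x - y)) := by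
              rw [← ENNReal.tsum_mul_left, ← ENNReal.tsum_mul_right]
              refine tsum_congr fun k => ?_
              rw [ENNReal.ofReal_mul (by positivity : (0 : ℝ) ≤ t ^ D)]; ring
          _ ≤ _ := by
              refine ENNReal.tsum_le_tsum fun k => ?_
              gcongr
              by_cases h : t * ‖y‖ ≤ 2 ^ k
              · have : ‖y‖ ≤ 2 ^ (k + (n + 1)) := by
                  rw [zpow_add₀ two_ne_zero, zpow_natCast]
                  calc ‖y‖ = (t * ‖y‖) * t⁻¹ := by field_simp
                    _ ≤ _ := by gcongr
                simp [indicator, this, h]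
              · simp [indicator, h]
    _ = ∑' k : ℕ, ENNReal.ofReal (t ^ D * (2 ^ k / 2) ^ (-β)) *
          ∫⁻ y, (Iic ((2 : ℝ) ^ (k + (n + 1)))).indicator 1 ‖y‖ * g (x - y) ∂μ := by
        have hm : ∀ k : ℤ, Measurable fun y : E =>
            (Iic ((2 : ℝ) ^ k)).indicator (1 : ℝ → ℝ≥0∞) ‖y‖ * g (x - y) := fun k =>
          (((measurable_one.indicator measurableSet_Iic).comp measurable_norm)).mul
            (hg.comp (measurable_const.sub measurable_id))
        rw [lintegral_tsum fun k => ((hm _).const_mul _).aemeasurable]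
        exact tsum_congr fun k => lintegral_const_mul _ (hm _)
    _ ≤ ∑' k : ℕ, ENNReal.ofReal (c * q ^ k) *
          (μ (closedBall 0 1) * dyadicMaximal μ g x) := by
        refine ENNReal.tsum_le_tsum fun k => ?_
        refine (mul_le_mul_right (lintegral_indicator_norm_le_mul_comp_sub_le μ g x _) _).trans ?_
        rw [← mul_assoc, ← mul_assoc, ← ENNReal.ofReal_mul (by positivity), mul_assoc]
        refine mul_le_mul_left (ENNReal.ofReal_le_ofReal ?_) _
        have e1 : ((2 : ℝ) ^ k / 2) ^ (-β) = 2 ^ β * (2 ^ (-β)) ^ k := by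
          rw [Real.div_rpow (by positivity) two_pos.le, ← Real.rpow_natCast_mul two_pos.le,
            ← Real.rpow_mul_natCast two_pos.le, Real.rpow_neg two_pos.le β, mul_comm (k : ℝ)]
          field_simp
        have e2 : q ^ k = (2 ^ (-β)) ^ k * ((2 : ℝ) ^ k) ^ D := by
          rw [← pow_mul, mul_comm k D, pow_mul, ← mul_pow]
          congr 1
          simp only [q]
          rw [sub_eq_neg_add, Real.rpow_add two_pos, Real.rpow_natCast]
        have e3 : ((2 : ℝ) ^ ((k : ℤ) + (n + 1))) ^ D = (2 ^ k) ^ D * (2 ^ n) ^ D * 2 ^ D := by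
          rw [zpow_add₀ two_ne_zero, zpow_natCast, zpow_add_one₀ two_ne_zero, mul_pow, mul_pow,
            mul_assoc]
        calc t ^ D * ((2 : ℝ) ^ k / 2) ^ (-β) * (2 ^ ((k : ℤ) + (n + 1))) ^ D
            = (t * 2 ^ n) ^ D * (c * q ^ k) := by rw [e1, e2, e3, mul_pow]; ring
          _ ≤ 1 * (c * q ^ k) := by
              gcongr
              exact pow_le_one₀ (by positivity) htn
          _ = _ := one_mul _
    _ = _ := by rw [ENNReal.tsum_mul_right, ← mul_assoc]

/-- The maximal function, in the first variable, of the average over the second variable. -/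
noncomputable def partialMaximal (ν : Measure ℝ) (f : E × ℝ → ℝ≥0∞) (z : E × ℝ) : ℝ≥0∞ :=
  dyadicMaximal μ (fun x => ∫⁻ v, f (x, z.2 - v) ∂ν) z.1

/-- At each fixed height the maximal theorem applies to the averaged slice; the vertical average is
then removed by Hölder. -/
theorem exists_lintegral_partialMaximal_rpow_le (ν : Measure ℝ) [IsFiniteMeasure ν] {p : ℝ}
    (hp : 1 < p) : ∃ C : ℝ≥0, ∀ f : E × ℝ → ℝ≥0∞, Measurable f →
      ∫⁻ z, partialMaximal μ ν f z ^ p ∂(μ.prod volume)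
        ≤ C * ∫⁻ z, f z ^ p ∂(μ.prod volume) := by
  obtain ⟨C, hC⟩ := exists_lintegral_dyadicMaximal_rpow_le μ hp
  have hfin : ν univ ^ p ≠ ⊤ :=
    ENNReal.rpow_ne_top_of_nonneg (by linarith) (measure_ne_top _ _)
  refine ⟨C * (ν univ ^ p).toNNReal, fun f hf => ?_⟩
  have hG : Measurable fun w : ℝ × E => ∫⁻ v, f (w.2, w.1 - v) ∂ν :=
    Measurable.lintegral_prod_right' (f := fun u : (ℝ × E) × ℝ => f (u.1.2, u.1.1 - u.2))
      (hf.comp (by fun_prop))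
  have hM' : Measurable fun w : ℝ × E =>
      dyadicMaximal μ (fun x => ∫⁻ v, f (x, w.1 - v) ∂ν) w.2 := measurable_dyadicMaximal_prod μ hG
  have hM : Measurable (partialMaximal μ ν f) := by
    have h := hM'.comp (measurable_swap (α := E) (β := ℝ))
    simp only [Function.comp_def, Prod.fst_swap, Prod.snd_swap] at h
    exact h
  have hGs : ∀ s : ℝ, Measurable fun x : E => ∫⁻ v, f (x, s - v) ∂ν := fun s =>
    hG.comp measurable_prodMk_left
  rw [ENNReal.coe_mul, ENNReal.coe_toNNReal hfin, mul_assoc]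
  calc _ = ∫⁻ s, ∫⁻ x, partialMaximal μ ν f (x, s) ^ p ∂μ :=
        lintegral_prod_symm _ (hM.pow_const p).aemeasurable
    _ ≤ ∫⁻ s, C * ∫⁻ x, (∫⁻ v, f (x, s - v) ∂ν) ^ p ∂μ :=
        lintegral_mono fun s => hC (fun x => ∫⁻ v, f (x, s - v) ∂ν) (hGs s)
    _ = C * ∫⁻ z, (∫⁻ v, f (z.1, z.2 - v) ∂ν) ^ p ∂(μ.prod volume) := by
        rw [lintegral_const_mul' _ _ ENNReal.coe_ne_top, lintegral_prod_symm]
        exact ((hG.comp measurable_swap).pow_const p).aemeasurable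
    _ ≤ _ := by gcongr; exact lintegral_rpow_lintegral_sub_le μ ν hp hf

theorem exists_lintegral_le_partialMaximal (ν : Measure ℝ) [SFinite ν] {β : ℝ}
    (hβ : finrank ℝ E < β) :
    ∃ C : ℝ≥0, ∀ f : E × ℝ → ℝ≥0∞, Measurable f → ∀ t : ℝ, 0 < t → ∀ z : E × ℝ,
      ∫⁻ y, ENNReal.ofReal (t ^ finrank ℝ E * (1 + t * ‖y‖) ^ (-β)) *
        ∫⁻ v, f (z.1 - y, z.2 - v) ∂ν ∂μ ≤ C * partialMaximal μ ν f z := by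
  obtain ⟨C, hC⟩ := exists_lintegral_dilate_le_dyadicMaximal μ hβ
  refine ⟨C, fun f hf t ht z => hC (fun x => ∫⁻ v, f (x, z.2 - v) ∂ν) ?_ t ht z.1⟩
  exact Measurable.lintegral_prod_right' (f := fun u : E × ℝ => f (u.1, z.2 - u.2))
    (hf.comp (by fun_prop))

end

end ConeMultiplier

/-! ### Decay of the one-dimensional integrals with weight `(1 - u²)^a`. -/

namespace ConeMultiplier

open Polynomial

theorem intervalIntegrable_one_sub_rpow {a : ℝ} (ha : -1 < a) (c d : ℝ) :
    IntervalIntegrable (fun u : ℝ => (1 - u) ^ a) volume c d := by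
  simpa using (intervalIntegral.intervalIntegrable_rpow' ha (a := 1 - c) (b := 1 - d)).comp_sub_left 1

theorem intervalIntegrable_one_add_rpow {a : ℝ} (ha : -1 < a) (c d : ℝ) :
    IntervalIntegrable (fun u : ℝ => (1 + u) ^ a) volume c d := by
  simpa using (intervalIntegral.intervalIntegrable_rpow' ha (a := 1 + c) (b := 1 + d)).comp_add_left 1

/-- Separates the two endpoint singularities: in `(1 - u)(1 + u)` the factor that is at least `1`
can be dropped, since `a ≤ 0`. -/
theorem one_sub_sq_rpow_le {a u : ℝ} (ha : a ≤ 0) (hu : u ∈ Ioo (-1 : ℝ) 1) :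
    (1 - u ^ 2) ^ a ≤ (1 - u) ^ a + (1 + u) ^ a := by
  obtain ⟨h1, h2⟩ := hu
  have p1 : 0 < 1 - u := by linarith
  have p2 : 0 < 1 + u := by linarith
  rcases le_total 0 u with h | h
  · have := Real.rpow_le_rpow_of_nonpos p1 (by nlinarith : 1 - u ≤ 1 - u ^ 2) ha
    have := Real.rpow_nonneg p2.le a
    linarith
  · have := Real.rpow_le_rpow_of_nonpos p2 (by nlinarith : 1 + u ≤ 1 - u ^ 2) ha
    have := Real.rpow_nonneg p1.le a
    linarith

theorem intervalIntegrable_one_sub_sq_rpow {a : ℝ} (ha : -1 < a) :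
    IntervalIntegrable (fun u : ℝ => (1 - u ^ 2) ^ a) volume (-1) 1 := by
  rcases le_or_gt a 0 with h | h
  · refine ((intervalIntegrable_one_sub_rpow ha (-1) 1).add
      (intervalIntegrable_one_add_rpow ha (-1) 1)).mono_fun'
      (Measurable.aestronglyMeasurable (by fun_prop)) ?_
    rw [uIoc_of_le (by norm_num), ← restrict_Ioo_eq_restrict_Ioc]
    filter_upwards [self_mem_ae_restrict measurableSet_Ioo] with u hu
    have hu0 : 0 ≤ 1 - u ^ 2 := by nlinarith [hu.1, hu.2]
    rw [Real.norm_of_nonneg (Real.rpow_nonneg hu0 a)]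
    exact one_sub_sq_rpow_le h hu
  · exact (Continuous.rpow_const (by fun_prop) fun _ => Or.inr h.le).intervalIntegrable _ _

/-- Cut at `ρ`: below it `g` is bounded by `B` and the power is integrated; above it the power is at
most `ρ ^ a` and the mass of `g` is used. -/
theorem integral_rpow_mul_le {a ρ B : ℝ} (ha : -1 < a) (ha0 : a ≤ 0) (hρ : 0 < ρ) (hρ1 : ρ ≤ 2)
    {g : ℝ → ℝ} (hg : Continuous g) (hg0 : ∀ w, 0 ≤ g w) (hgB : ∀ w, g w ≤ B)
    (hgi : Integrable g) :
    ∫ w in (0 : ℝ)..2, w ^ a * g w ≤ B * (ρ ^ (a + 1) / (a + 1)) + ρ ^ a * ∫ w, g w := by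
  have hi : ∀ c d : ℝ, IntervalIntegrable (fun w : ℝ => w ^ a * g w) volume c d := fun c d =>
    (intervalIntegral.intervalIntegrable_rpow' ha).mul_continuousOn hg.continuousOn
  rw [← intervalIntegral.integral_add_adjacent_intervals (hi 0 ρ) (hi ρ 2)]
  gcongr
  · calc ∫ w in (0 : ℝ)..ρ, w ^ a * g w ≤ ∫ w in (0 : ℝ)..ρ, B * w ^ a := by
          refine intervalIntegral.integral_mono_on hρ.le (hi _ _)
            ((intervalIntegral.intervalIntegrable_rpow' ha).const_mul B) fun w hw => ?_
          rw [mul_comm]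
          exact mul_le_mul_of_nonneg_right (hgB w) (Real.rpow_nonneg hw.1 a)
      _ = _ := by
          rw [intervalIntegral.integral_const_mul, integral_rpow (Or.inl ha),
            Real.zero_rpow (by linarith), sub_zero]
  · calc ∫ w in ρ..2, w ^ a * g w ≤ ∫ w in ρ..2, ρ ^ a * g w := by
          refine intervalIntegral.integral_mono_on hρ1 (hi _ _)
            ((hg.intervalIntegrable _ _).const_mul _) fun w hw => ?_
          exact mul_le_mul_of_nonneg_right
            (Real.rpow_le_rpow_of_nonpos hρ hw.1 ha0) (hg0 w)
      _ ≤ _ := by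
          rw [intervalIntegral.integral_const_mul, intervalIntegral.integral_of_le hρ1]
          exact mul_le_mul_of_nonneg_left
            (setIntegral_le_integral hgi (Filter.Eventually.of_forall hg0)) (by positivity)

theorem integral_one_sub_sq_rpow_mul_le {a r B : ℝ} (ha : -1 < a) (ha0 : a ≤ 0) (hr : 1 ≤ r)
    {h : ℝ → ℝ} (hc : Continuous h) (h0 : ∀ s, 0 ≤ h s) (hB : ∀ s, h s ≤ B) (hi : Integrable h)
    (x : ℝ) : ∫ u in (-1 : ℝ)..1, (1 - u ^ 2) ^ a * h (r * u + x)
      ≤ 2 * (B / (a + 1) + ∫ s, h s) * r ^ (-a - 1) := by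
  have hr0 : 0 < r := by linarith
  set J := ∫ s, h s
  -- The cut `ρ = r⁻¹` balances the two terms: the mass of `w ↦ h (σ w + y)` is `r⁻¹ J`, so both are
  -- of order `r ^ (-a - 1)`.
  have half : ∀ σ : ℝ, |σ| = r → ∀ y, ∫ w in (0 : ℝ)..2, w ^ a * h (σ * w + y)
      ≤ (B / (a + 1) + J) * r ^ (-a - 1) := by
    intro σ hσ y
    have hσ0 : σ ≠ 0 := by rw [← abs_pos, hσ]; exact hr0
    have hint : Integrable fun w => h (σ * w + y) :=
      (hi.comp_add_right y).comp_mul_left' hσ0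
    have hJ : ∫ w, h (σ * w + y) = r⁻¹ * J := by
      rw [Measure.integral_comp_mul_left (fun w => h (w + y)) σ, integral_add_right_eq_self h y,
        abs_inv, hσ, smul_eq_mul]
    refine (integral_rpow_mul_le ha ha0 (inv_pos.2 hr0) ((inv_le_one_of_one_le₀ hr).trans
      one_le_two) (g := fun w => h (σ * w + y)) (by fun_prop) (fun _ => h0 _) (fun _ => hB _)
      hint).trans_eq ?_
    rw [hJ, Real.inv_rpow hr0.le, Real.inv_rpow hr0.le, ← Real.rpow_neg hr0.le,
      ← Real.rpow_neg hr0.le, neg_add, ← sub_eq_add_neg, Real.rpow_sub_one hr0.ne']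
    ring
  have hh : Continuous fun u => h (r * u + x) := by fun_prop
  have i1 : IntervalIntegrable (fun u => (1 - u) ^ a * h (r * u + x)) volume (-1) 1 :=
    (intervalIntegrable_one_sub_rpow ha _ _).mul_continuousOn hh.continuousOn
  have i2 : IntervalIntegrable (fun u => (1 + u) ^ a * h (r * u + x)) volume (-1) 1 :=
    (intervalIntegrable_one_add_rpow ha _ _).mul_continuousOn hh.continuousOn
  have e1 : ∫ u in (-1 : ℝ)..1, (1 - u) ^ a * h (r * u + x)
      = ∫ w in (0 : ℝ)..2, w ^ a * h (-r * w + (r + x)) := by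
    rw [show (0 : ℝ) = 1 - 1 by norm_num, show (2 : ℝ) = 1 - (-1) by norm_num,
      ← intervalIntegral.integral_comp_sub_left (fun w => w ^ a * h (-r * w + (r + x))) 1]
    refine intervalIntegral.integral_congr fun u _ => ?_
    congr 2; ring
  have e2 : ∫ u in (-1 : ℝ)..1, (1 + u) ^ a * h (r * u + x)
      = ∫ w in (0 : ℝ)..2, w ^ a * h (r * w + (x - r)) := by
    rw [show (0 : ℝ) = 1 + -1 by norm_num, show (2 : ℝ) = 1 + 1 by norm_num,
      ← intervalIntegral.integral_comp_add_left (fun w => w ^ a * h (r * w + (x - r))) 1]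
    refine intervalIntegral.integral_congr fun u _ => ?_
    congr 2; ring
  calc ∫ u in (-1 : ℝ)..1, (1 - u ^ 2) ^ a * h (r * u + x)
      ≤ ∫ u in (-1 : ℝ)..1, ((1 - u) ^ a * h (r * u + x) + (1 + u) ^ a * h (r * u + x)) := by
        refine intervalIntegral.integral_mono_on_of_le_Ioo (by norm_num)
          ((intervalIntegrable_one_sub_sq_rpow ha).mul_continuousOn hh.continuousOn)
          (i1.add i2) fun u hu => ?_
        rw [← add_mul]
        exact mul_le_mul_of_nonneg_right (one_sub_sq_rpow_le ha0 hu) (h0 _)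
    _ ≤ (B / (a + 1) + J) * r ^ (-a - 1) + (B / (a + 1) + J) * r ^ (-a - 1) := by
        rw [intervalIntegral.integral_add i1 i2, e1, e2]
        exact add_le_add (half (-r) (by rw [abs_neg, abs_of_pos hr0]) _)
          (half r (abs_of_pos hr0) _)
    _ = _ := by ring

/-- The integral `∫_{-1}^1 q(u) (1 - u²)^a Φ(r u + x) du`. -/
noncomputable def sphericalAverage (q : ℝ[X]) (a : ℝ) (Φ : ℝ → ℂ) (r x : ℝ) : ℂ :=
  ∫ u in (-1 : ℝ)..1, ((q.eval u * (1 - u ^ 2) ^ a : ℝ) : ℂ) * Φ (r * u + x)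

/-- In this range absolute values suffice, with no cancellation in `Φ`. It is the base case for
larger exponents. -/
theorem exists_norm_sphericalAverage_le_of_nonpos {a : ℝ} (ha : -1 < a) (ha0 : a ≤ 0) (q : ℝ[X])
    (Φ : 𝓢(ℝ, ℂ)) :
    ∃ C, ∀ r, 1 ≤ r → ∀ x, ‖sphericalAverage q a Φ r x‖ ≤ C * r ^ (-a - 1) := by
  obtain ⟨Q, hQ⟩ := isCompact_Icc.exists_bound_of_continuousOn (s := Icc (-1 : ℝ) 1)
    q.continuous.continuousOn
  have hQ0 : 0 ≤ Q := (norm_nonneg _).trans (hQ 0 (by norm_num))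
  set B := SchwartzMap.seminorm ℝ 0 0 Φ
  have hB : ∀ s, ‖Φ s‖ ≤ B := Φ.norm_le_seminorm ℝ
  have hΦc : Continuous fun s => ‖Φ s‖ := Φ.continuous.norm
  refine ⟨Q * (2 * (B / (a + 1) + ∫ s, ‖Φ s‖)), fun r hr x => ?_⟩
  have hh : Continuous fun u => ‖Φ (r * u + x)‖ := by fun_prop
  calc ‖sphericalAverage q a Φ r x‖
      ≤ ∫ u in (-1 : ℝ)..1, Q * ((1 - u ^ 2) ^ a * ‖Φ (r * u + x)‖) := by
        refine intervalIntegral.norm_integral_le_of_norm_le (by norm_num)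
          (Filter.Eventually.of_forall fun u hu => ?_)
          (((intervalIntegrable_one_sub_sq_rpow ha).mul_continuousOn hh.continuousOn).const_mul Q)
        have hu0 : 0 ≤ (1 - u ^ 2) ^ a := Real.rpow_nonneg (by nlinarith [hu.1, hu.2]) a
        rw [norm_mul, Complex.norm_real, norm_mul, Real.norm_of_nonneg hu0, mul_assoc]
        gcongr
        exact hQ u ⟨hu.1.le, hu.2⟩
    _ ≤ Q * (2 * (B / (a + 1) + ∫ s, ‖Φ s‖) * r ^ (-a - 1)) := by
        rw [intervalIntegral.integral_const_mul]
        gcongr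
        exact integral_one_sub_sq_rpow_mul_le ha ha0 hr hΦc (fun _ => norm_nonneg _) hB
          Φ.integrable.norm x
    _ = _ := by ring

/-- Integration by parts; the boundary terms vanish because `a > 0`. Differentiating the weight
leaves `(1 - u²)^(a-1)` times a new polynomial, which is why a polynomial factor is carried along.
-/
theorem sphericalAverage_eq_of_hasDerivAt {a : ℝ} (ha : 0 < a) (q : ℝ[X]) {Φ Ψ : ℝ → ℂ}
    (hΨ : ∀ s, HasDerivAt Ψ (Φ s) s) (hΦ : Continuous Φ) {r : ℝ} (hr : r ≠ 0) (x : ℝ) :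
    sphericalAverage q a Φ r x
      = -((r⁻¹ : ℝ) : ℂ) *
        sphericalAverage (derivative q * (1 - X ^ 2) - C (2 * a) * X * q) (a - 1) Ψ r x := by
  have hΨc : Continuous Ψ := continuous_iff_continuousAt.2 fun s => (hΨ s).continuousAt
  set q' := derivative q * (1 - X ^ 2) - C (2 * a) * X * q
  have hcont : Continuous fun u : ℝ => q.eval u * (1 - u ^ 2) ^ a :=
    q.continuous.mul (Continuous.rpow_const (by fun_prop) fun _ => Or.inr ha.le)
  have hder : ∀ u ∈ Ioo (-1 : ℝ) 1,
      HasDerivAt (fun u : ℝ => q.eval u * (1 - u ^ 2) ^ a) (q'.eval u * (1 - u ^ 2) ^ (a - 1)) u := by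
    intro u hu
    have hu0 : 0 < 1 - u ^ 2 := by nlinarith [hu.1, hu.2]
    have h1 : HasDerivAt (fun u : ℝ => 1 - u ^ 2) (-(2 * u)) u := by
      simpa using ((hasDerivAt_pow 2 u).const_sub 1)
    refine ((q.hasDerivAt u).mul (h1.rpow_const (p := a) (Or.inl hu0.ne'))).congr_deriv ?_
    have : (1 - u ^ 2) ^ a = (1 - u ^ 2) * (1 - u ^ 2) ^ (a - 1) := by
      rw [Real.rpow_sub_one hu0.ne']; field_simp
    rw [this]
    simp [q']
    ring
  have hv : ∀ u : ℝ, HasDerivAt (fun u => ((r⁻¹ : ℝ) : ℂ) * Ψ (r * u + x)) (Φ (r * u + x)) u := by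
    intro u
    have h1 : HasDerivAt (fun u : ℝ => r * u + x) r u := by
      simpa using ((hasDerivAt_id u).const_mul r).add_const x
    refine (((hΨ (r * u + x)).scomp u h1).const_mul ((r⁻¹ : ℝ) : ℂ)).congr_deriv ?_
    rw [Complex.real_smul, ← mul_assoc, ← Complex.ofReal_mul, inv_mul_cancel₀ hr,
      Complex.ofReal_one, one_mul]
  have hd : IntervalIntegrable (fun u : ℝ => q'.eval u * (1 - u ^ 2) ^ (a - 1)) volume (-1) 1 :=
    (intervalIntegrable_one_sub_sq_rpow (by linarith)).continuousOn_mul q'.continuous.continuousOn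
  have hdC : IntervalIntegrable (fun u : ℝ => ((q'.eval u * (1 - u ^ 2) ^ (a - 1) : ℝ) : ℂ))
      volume (-1) 1 := ⟨hd.1.ofReal, hd.2.ofReal⟩
  have ibp := intervalIntegral.integral_mul_deriv_eq_deriv_mul_of_hasDerivAt
    (a := (-1 : ℝ)) (b := 1)
    (u := fun u : ℝ => ((q.eval u * (1 - u ^ 2) ^ a : ℝ) : ℂ))
    (v := fun u => ((r⁻¹ : ℝ) : ℂ) * Ψ (r * u + x))
    (u' := fun u : ℝ => ((q'.eval u * (1 - u ^ 2) ^ (a - 1) : ℝ) : ℂ))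
    (v' := fun u => Φ (r * u + x))
    (Complex.continuous_ofReal.comp hcont).continuousOn
    (by fun_prop)
    (fun u hu => (hder u (by simpa using hu)).ofReal_comp) (fun u _ => hv u)
    hdC (Continuous.intervalIntegrable (by fun_prop) _ _)
  unfold sphericalAverage
  rw [ibp]
  simp only [one_pow, sub_self, Real.zero_rpow ha.ne', mul_zero, Complex.ofReal_zero, zero_mul,
    neg_one_sq, zero_sub, ← intervalIntegral.integral_neg, ← intervalIntegral.integral_const_mul]
  exact intervalIntegral.integral_congr fun u _ => by ring

/-- Each integration by parts gains `r⁻¹` and lowers `a` by one, so the rate `r ^ (-a - 1)` is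
preserved down to the base case. The polynomial and the index of the primitive change at each step,
hence the generality in `q` and `k`. -/
theorem exists_norm_sphericalAverage_le (Φ : ℕ → 𝓢(ℝ, ℂ))
    (hΦ : ∀ k s, HasDerivAt (Φ (k + 1)) (Φ k s) s) {a : ℝ} (ha : -1 < a) (q : ℝ[X]) (k : ℕ) :
    ∃ C, ∀ r, 1 ≤ r → ∀ x, ‖sphericalAverage q a (Φ k) r x‖ ≤ C * r ^ (-a - 1) := by
  obtain ⟨N, hN⟩ := exists_nat_ge a
  induction N generalizing a q k with
  | zero => exact exists_norm_sphericalAverage_le_of_nonpos ha (by simpa using hN) q (Φ k)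
  | succ N ih =>
    rcases le_or_gt a N with h | h
    · exact ih ha q k h
    have ha0 : 0 < a := lt_of_le_of_lt (Nat.cast_nonneg N) h
    obtain ⟨C, hC⟩ := ih (a := a - 1) (by linarith)
      (derivative q * (1 - X ^ 2) - Polynomial.C (2 * a) * X * q) (k + 1)
      (by push_cast at hN; linarith)
    refine ⟨C, fun r hr x => ?_⟩
    have hr0 : 0 < r := by linarith
    rw [sphericalAverage_eq_of_hasDerivAt ha0 q (hΦ k) (Φ k).continuous hr0.ne', norm_mul, norm_neg,
      Complex.norm_real, Real.norm_of_nonneg (inv_pos.2 hr0).le]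
    calc r⁻¹ * _ ≤ r⁻¹ * (C * r ^ (-(a - 1) - 1)) := by gcongr; exact hC r hr x
      _ = C * r ^ (-a - 1) := by
        rw [show -(a - 1) - 1 = -a by ring, Real.rpow_sub_one hr0.ne']; ring

theorem norm_sphericalAverage_one_le {a : ℝ} (ha : 0 ≤ a) {Φ : ℝ → ℂ} {r x B : ℝ}
    (hB : ∀ u ∈ Icc (-1 : ℝ) 1, ‖Φ (r * u + x)‖ ≤ B) : ‖sphericalAverage 1 a Φ r x‖ ≤ 2 * B := by
  have hB0 : 0 ≤ B := (norm_nonneg _).trans (hB 0 (by norm_num))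
  refine (intervalIntegral.norm_integral_le_of_norm_le_const (C := B) fun u hu => ?_).trans_eq ?_
  · rw [uIoc_of_le (by norm_num)] at hu
    have h0 : 0 ≤ 1 - u ^ 2 := by nlinarith [hu.1, hu.2]
    have h1 : (1 - u ^ 2) ^ a ≤ 1 := Real.rpow_le_one h0 (by nlinarith) ha
    rw [norm_mul, Complex.norm_real, eval_one, one_mul, Real.norm_of_nonneg (Real.rpow_nonneg h0 a)]
    calc _ ≤ 1 * B := mul_le_mul h1 (hB u ⟨hu.1.le, hu.2⟩) (norm_nonneg _) zero_le_one
      _ = B := one_mul B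
  · norm_num [mul_comm]

/-- Three regions, one for each summand of the constant. If `|x| ≥ 2r`, then `|r u + x| ≥ |x| / 2`
and Schwartz decay is enough. If `|x| < 2r` and `r ≥ 1`, the decay `r ^ (-a - 1)` is shared between
the two factors. Otherwise `r < 1` and `|x| < 2`, and boundedness suffices. -/
theorem exists_norm_sphericalAverage_le_mul (Φ : ℕ → 𝓢(ℝ, ℂ))
    (hΦ : ∀ k s, HasDerivAt (Φ (k + 1)) (Φ k s) s) {a β γ : ℝ} (ha : 0 ≤ a) (hβ : 0 ≤ β)
    (hγ : 0 ≤ γ) (hsum : β + γ ≤ a + 1) :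
    ∃ C, 0 ≤ C ∧ ∀ r, 0 ≤ r → ∀ x,
      ‖sphericalAverage 1 a (Φ 0) r x‖ ≤ C * ((1 + r) ^ (-β) * (1 + |x|) ^ (-γ)) := by
  obtain ⟨C₁, hC₁⟩ := exists_norm_sphericalAverage_le Φ hΦ (by linarith : -1 < a) 1 0
  obtain ⟨M, hM⟩ := exists_nat_ge (β + γ)
  set S := 2 ^ M * ((Finset.Iic (M, 0)).sup fun m => SchwartzMap.seminorm ℝ m.1 m.2) (Φ 0)
  have hS : ∀ s, (1 + |s|) ^ M * ‖Φ 0 s‖ ≤ S := fun s => by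
    simpa using SchwartzMap.one_add_le_sup_seminorm_apply (𝕜 := ℝ) (m := (M, 0)) le_rfl le_rfl
      (Φ 0) s
  have hS0 : 0 ≤ S := le_trans (by positivity) (hS 0)
  have hbd : ∀ s, ‖Φ 0 s‖ ≤ S := fun s => by
    refine le_trans ?_ (hS s)
    exact le_mul_of_one_le_left (norm_nonneg _) (one_le_pow₀ (by linarith [abs_nonneg s]))
  have hC₁0 : 0 ≤ C₁ := by simpa using (norm_nonneg _).trans (hC₁ 1 le_rfl 0)
  refine ⟨2 ^ (M + 1) * S + 2 * S * (2 ^ β * 3 ^ γ) + C₁ * (2 ^ β * 3 ^ γ), by positivity,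
    fun r hr x => ?_⟩
  have hx := abs_nonneg x
  set P := (1 + r) ^ (-β) * (1 + |x|) ^ (-γ)
  have hP : 0 ≤ P := by positivity
  have t1 : 0 ≤ 2 ^ (M + 1) * S * P := by positivity
  have t2 : 0 ≤ 2 * S * (2 ^ β * 3 ^ γ) * P := by positivity
  have t3 : 0 ≤ C₁ * (2 ^ β * 3 ^ γ) * P := by positivity
  rw [add_mul, add_mul]
  rcases le_or_gt (2 * r) |x| with h | h
  · suffices ‖sphericalAverage 1 a (Φ 0) r x‖ ≤ 2 * (2 ^ M * S * P) by
      rw [pow_succ] at *; linarith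
    refine norm_sphericalAverage_one_le ha fun u hu => ?_
    have habs : |x| ≤ 2 * |r * u + x| := by
      have h1 : |r * u| ≤ r := by
        rw [abs_mul, abs_of_nonneg hr]
        exact mul_le_of_le_one_right hr (abs_le.2 hu)
      have h2 := abs_sub_abs_le_abs_sub x (-(r * u))
      rw [abs_neg, sub_neg_eq_add, add_comm x] at h2
      linarith
    have hP' : (1 + |x|) ^ (-(M : ℝ)) ≤ P := by
      calc (1 + |x|) ^ (-(M : ℝ)) ≤ (1 + |x|) ^ (-β + -γ) :=
            Real.rpow_le_rpow_of_exponent_le (by linarith) (by linarith)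
        _ = (1 + |x|) ^ (-β) * (1 + |x|) ^ (-γ) := Real.rpow_add (by linarith) _ _
        _ ≤ P := mul_le_mul_of_nonneg_right (Real.rpow_le_rpow_of_nonpos (by linarith)
            (by linarith) (by linarith)) (by positivity)
    refine le_trans ?_ (mul_le_mul_of_nonneg_left hP' (by positivity))
    rw [Real.rpow_neg (by positivity), Real.rpow_natCast, ← div_eq_mul_inv,
      le_div_iff₀ (by positivity), mul_comm]
    calc (1 + |x|) ^ M * ‖Φ 0 (r * u + x)‖
        ≤ (2 * (1 + |r * u + x|)) ^ M * ‖Φ 0 (r * u + x)‖ := by gcongr; linarith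
      _ = 2 ^ M * ((1 + |r * u + x|) ^ M * ‖Φ 0 (r * u + x)‖) := by rw [mul_pow, mul_assoc]
      _ ≤ _ := by gcongr; exact hS _
  -- To be used with `R = max r 1`: since `|x| < 2r`, one has `1 + r ≤ 2R` and `1 + |x| ≤ 3R`.
  · have hmul : ∀ R, 1 ≤ R → 1 + r ≤ 2 * R → 1 + |x| ≤ 3 * R →
        R ^ (-a - 1) ≤ 2 ^ β * 3 ^ γ * P := by
      intro R hR h1 h2
      have hR0 : 0 < R := by linarith
      calc R ^ (-a - 1) ≤ R ^ (-β + -γ) :=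
            Real.rpow_le_rpow_of_exponent_le hR (by linarith)
        _ = 2 ^ β * 3 ^ γ * ((2 * R) ^ (-β) * (3 * R) ^ (-γ)) := by
            rw [Real.mul_rpow two_pos.le hR0.le, Real.mul_rpow three_pos.le hR0.le,
              Real.rpow_add hR0, Real.rpow_neg two_pos.le, Real.rpow_neg three_pos.le]
            field_simp
        _ ≤ _ := by
            refine mul_le_mul_of_nonneg_left (mul_le_mul ?_ ?_ (by positivity) (by positivity))
              (by positivity)
            · exact Real.rpow_le_rpow_of_nonpos (by linarith) h1 (by linarith)
            · exact Real.rpow_le_rpow_of_nonpos (by linarith) h2 (by linarith)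
    rcases le_or_gt 1 r with hr1 | hr1
    · have := mul_le_mul_of_nonneg_left (hmul r hr1 (by linarith) (by linarith)) hC₁0
      have := hC₁ r hr1 x
      linarith
    · have h1 := hmul 1 le_rfl (by linarith) (by linarith)
      rw [Real.one_rpow] at h1
      have h2 := norm_sphericalAverage_one_le (r := r) (x := x) ha fun u _ => hbd (r * u + x)
      nlinarith

end ConeMultiplier

namespace ConeMultiplier

open Real (fourierChar)

/-! ### Splitting off the last coordinate. -/

section Splitting

variable {d : ℕ}

/-- The splitting `x ↦ (x', x_n)` as a measurable equivalence. -/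
noncomputable def splitEquiv (d : ℕ) : Space d ≃ᵐ EuclideanSpace ℝ (Fin d) × ℝ :=
  (MeasurableEquiv.toLp 2 (Fin (d + 1) → ℝ)).symm.trans <|
    (MeasurableEquiv.piFinSuccAbove (fun _ => ℝ) (Fin.last d)).trans <|
      MeasurableEquiv.prodComm.trans <|
        (MeasurableEquiv.toLp 2 (Fin d → ℝ)).prodCongr (MeasurableEquiv.refl ℝ)

theorem splitEquiv_apply (x : Space d) : splitEquiv d x = (horiz x, vert x) := by
  have : (Fin.last d).removeNth (WithLp.ofLp x) = fun i : Fin d => x i.castSucc := by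
    ext i; simp [Fin.removeNth]
  ext1
  · exact congrArg (WithLp.toLp 2) this
  · rfl

theorem measurePreserving_splitEquiv : MeasurePreserving (splitEquiv d) := by
  have h1 : MeasurePreserving (MeasurableEquiv.toLp 2 (Fin (d + 1) → ℝ)).symm :=
    PiLp.volume_preserving_ofLp (Fin (d + 1))
  have h2 := volume_preserving_piFinSuccAbove (fun _ : Fin (d + 1) => ℝ) (Fin.last d)
  have h3 : MeasurePreserving (Prod.swap : ℝ × (Fin d → ℝ) → (Fin d → ℝ) × ℝ) :=
    Measure.measurePreserving_swap
  have h4 : MeasurePreserving (MeasurableEquiv.toLp 2 (Fin d → ℝ)) :=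
    PiLp.volume_preserving_toLp (Fin d)
  have h5 : MeasurePreserving
      (Prod.map (MeasurableEquiv.toLp 2 (Fin d → ℝ)) (id : ℝ → ℝ)) :=
    h4.prod (MeasurePreserving.id volume)
  exact h5.comp (h3.comp (h2.comp h1))

theorem inner_eq_horiz_add_vert (x y : Space d) :
    inner ℝ x y = inner ℝ (horiz x) (horiz y) + vert x * vert y := by
  simp [PiLp.inner_apply, Fin.sum_univ_castSucc, horiz, vert, mul_comm]

theorem norm_sq_eq_horiz_add_vert (x : Space d) : ‖x‖ ^ 2 = ‖horiz x‖ ^ 2 + vert x ^ 2 := by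
  rw [← real_inner_self_eq_norm_sq, inner_eq_horiz_add_vert, real_inner_self_eq_norm_sq, sq (vert x)]

/-- Serves twice: to slice the ball profile along an axis, and to slice the cone multiplier by
height. -/
theorem fourierInv_comp_split {F : EuclideanSpace ℝ (Fin d) × ℝ → ℂ} (hF : Integrable F)
    (x : Space d) :
    𝓕⁻ (fun ξ : Space d => F (horiz ξ, vert ξ)) x
      = ∫ v, fourierChar (v * vert x) • 𝓕⁻ (fun η => F (η, v)) (horiz x) := by
  have h : ∀ ξ : Space d, fourierChar (inner ℝ ξ x) • F (horiz ξ, vert ξ)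
      = (fun z : EuclideanSpace ℝ (Fin d) × ℝ =>
        fourierChar (inner ℝ z.1 (horiz x) + z.2 * vert x) • F z) (splitEquiv d ξ) := fun ξ => by
    simp only [splitEquiv_apply, inner_eq_horiz_add_vert]
  rw [Real.fourierInv_eq, integral_congr_ae (Filter.Eventually.of_forall h)]
  refine (measurePreserving_splitEquiv.integral_comp' (fun z : EuclideanSpace ℝ (Fin d) × ℝ =>
    fourierChar (inner ℝ z.1 (horiz x) + z.2 * vert x) • F z)).trans ?_
  rw [Measure.volume_eq_prod, integral_prod_symm]
  · refine integral_congr_ae (Filter.Eventually.of_forall fun v => ?_)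
    simp only [Real.fourierInv_eq]
    rw [Circle.smul_def, ← integral_smul]
    refine integral_congr_ae (Filter.Eventually.of_forall fun η => ?_)
    simp only [AddChar.map_add_eq_mul, mul_comm (fourierChar (inner ℝ η (horiz x))), mul_smul,
      Circle.smul_def]
  · refine hF.norm.mono' ?_ (Filter.Eventually.of_forall fun z => by simp)
    exact (Continuous.aestronglyMeasurable (by fun_prop)).smul hF.aestronglyMeasurable

end Splitting

/-! ### The Fourier transform of the Bochner–Riesz profile. -/

section BallPower

variable {d : ℕ} {lam : ℝ}

/-- The Bochner–Riesz profile `(1 - ‖η‖²)_+^λ`. -/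
noncomputable def ballPower (lam : ℝ) {d : ℕ} (η : EuclideanSpace ℝ (Fin d)) : ℝ :=
  (max (1 - ‖η‖ ^ 2) 0) ^ lam

theorem continuous_ballPower (hlam : 0 < lam) :
    Continuous (ballPower lam : EuclideanSpace ℝ (Fin d) → ℝ) :=
  Continuous.rpow_const (by fun_prop) fun _ => Or.inr hlam.le

theorem ballPower_nonneg (η : EuclideanSpace ℝ (Fin d)) : 0 ≤ ballPower lam η :=
  Real.rpow_nonneg (le_max_right _ _) _

theorem ballPower_le_one (hlam : 0 < lam) (η : EuclideanSpace ℝ (Fin d)) : ballPower lam η ≤ 1 :=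
  Real.rpow_le_one (le_max_right _ _) (max_le (by nlinarith [norm_nonneg η]) zero_le_one) hlam.le

theorem ballPower_eq_zero (hlam : 0 < lam) {η : EuclideanSpace ℝ (Fin d)} (h : 1 ≤ ‖η‖) :
    ballPower lam η = 0 := by
  rw [ballPower, max_eq_right (by nlinarith), Real.zero_rpow hlam.ne']

theorem integrable_ballPower (hlam : 0 < lam) :
    Integrable (ballPower lam : EuclideanSpace ℝ (Fin d) → ℝ) := by
  refine (continuous_ballPower hlam).integrable_of_hasCompactSupport
    (HasCompactSupport.intro (isCompact_closedBall 0 1) fun η hη => ballPower_eq_zero hlam ?_)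
  rw [mem_closedBall_zero_iff, not_le] at hη
  exact hη.le

/-- The slice is `(1 - u²)^λ` times the profile dilated by `R = √(1 - u²)`; the Jacobian `R ^ d`
supplies the extra `d / 2` in the exponent. -/
theorem integral_ballPower_slice (hlam : 0 < lam) (u : ℝ) :
    ∫ η : EuclideanSpace ℝ (Fin d), (max (1 - (‖η‖ ^ 2 + u ^ 2)) 0) ^ lam
      = (max (1 - u ^ 2) 0) ^ (lam + d / 2) * ∫ η : EuclideanSpace ℝ (Fin d), ballPower lam η := by
  rcases le_or_gt (1 - u ^ 2) 0 with h | h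
  · have h1 : ∀ η : EuclideanSpace ℝ (Fin d), (max (1 - (‖η‖ ^ 2 + u ^ 2)) 0) ^ lam = 0 :=
      fun η => by rw [max_eq_right (by nlinarith [sq_nonneg ‖η‖]), Real.zero_rpow hlam.ne']
    simp_rw [h1, max_eq_right h]
    rw [Real.zero_rpow (by positivity), integral_zero, zero_mul]
  · set R := √(1 - u ^ 2)
    have hR : 0 < R := Real.sqrt_pos.2 h
    have hR2 : R ^ 2 = 1 - u ^ 2 := Real.sq_sqrt h.le
    have h1 : ∀ η : EuclideanSpace ℝ (Fin d), (max (1 - (‖η‖ ^ 2 + u ^ 2)) 0) ^ lam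
        = (1 - u ^ 2) ^ lam * ballPower lam (R⁻¹ • η) := by
      intro η
      rw [ballPower, ← Real.mul_rpow h.le (le_max_right _ _), mul_max_of_nonneg _ _ h.le, mul_zero,
        norm_smul, mul_pow, norm_inv, Real.norm_of_nonneg hR.le, inv_pow, hR2]
      congr 2
      field_simp
      ring
    simp_rw [h1]
    rw [integral_const_mul, Measure.integral_comp_inv_smul_of_nonneg _ _ hR.le,
      finrank_euclideanSpace_fin, max_eq_left h.le, Real.rpow_add h, smul_eq_mul, ← mul_assoc]
    congr 2
    rw [← Real.rpow_natCast, show R = (1 - u ^ 2) ^ (1 / 2 : ℝ) from Real.sqrt_eq_rpow _,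
      ← Real.rpow_mul h.le]
    congr 1
    ring

theorem exists_linearIsometryEquiv_apply_eq {F : Type*} [NormedAddCommGroup F]
    [InnerProductSpace ℝ F] [CompleteSpace F] {v w : F} (h : ‖v‖ = ‖w‖) :
    ∃ A : F ≃ₗᵢ[ℝ] F, A v = w :=
  ⟨_, Submodule.reflection_sub h⟩

/-- The inverse Fourier transform of the Bochner–Riesz profile, as a one-dimensional integral. -/
theorem fourierInv_ballPower (hlam : 0 < lam) (y : EuclideanSpace ℝ (Fin (d + 1))) :
    𝓕⁻ (fun η : EuclideanSpace ℝ (Fin (d + 1)) => (ballPower lam η : ℂ)) y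
      = ((∫ η : EuclideanSpace ℝ (Fin d), ballPower lam η : ℝ) : ℂ) *
        ∫ u in (-1 : ℝ)..1, (((1 - u ^ 2) ^ (lam + d / 2) : ℝ) : ℂ) * fourierChar (u * ‖y‖) := by
  set c := ∫ η : EuclideanSpace ℝ (Fin d), ballPower lam η
  -- The profile is radial, so `y` may be rotated onto the last axis. The phase then ignores the
  -- horizontal variables and only slice integrals remain.
  set w : Space d := EuclideanSpace.single (Fin.last d) ‖y‖
  have hw : ‖y‖ = ‖w‖ := by simp [w]
  have hw1 : horiz w = 0 := by
    ext i; simp [horiz, w]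
  have hw2 : vert w = ‖y‖ := by simp [vert, w]
  obtain ⟨A, hA⟩ := exists_linearIsometryEquiv_apply_eq hw
  set F : EuclideanSpace ℝ (Fin d) × ℝ → ℂ :=
    fun z => (((max (1 - (‖z.1‖ ^ 2 + z.2 ^ 2)) 0) ^ lam : ℝ) : ℂ)
  have hsplit : ∀ ξ : Space d, (ballPower lam ξ : ℂ) = F (horiz ξ, vert ξ) := fun ξ => by
    simp only [F, ballPower, norm_sq_eq_horiz_add_vert]
  have hF : Integrable F := by
    rw [← measurePreserving_splitEquiv.integrable_comp_emb (splitEquiv d).measurableEmbedding]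
    refine (integrable_ballPower hlam).ofReal.congr (Filter.Eventually.of_forall fun ξ => ?_)
    simp only [Function.comp_apply, splitEquiv_apply]
    exact hsplit ξ
  have hrot : (fun η : Space d => (ballPower lam η : ℂ))
      = (fun η : Space d => (ballPower lam η : ℂ)) ∘ A := by
    ext η; simp [ballPower]
  rw [hrot, Real.fourierInv_comp_linearIsometry, hA]
  simp_rw [hsplit]
  rw [fourierInv_comp_split hF, hw1, hw2]
  have hslice : ∀ v : ℝ, 𝓕⁻ (fun η => F (η, v)) 0
      = (((max (1 - v ^ 2) 0) ^ (lam + d / 2) * c : ℝ) : ℂ) := by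
    intro v
    rw [Real.fourierInv_eq, ← integral_ballPower_slice hlam]
    simp [F, integral_complex_ofReal]
  simp_rw [hslice]
  rw [intervalIntegral.integral_of_le (by norm_num), ← integral_const_mul,
    ← integral_indicator measurableSet_Ioc]
  refine integral_congr_ae (Filter.Eventually.of_forall fun u => ?_)
  simp only [Circle.smul_def, smul_eq_mul]
  by_cases hu : u ∈ Ioc (-1 : ℝ) 1
  · rw [indicator_of_mem hu, max_eq_left (by nlinarith [hu.1, hu.2])]
    push_cast
    ring
  · rw [indicator_of_notMem hu, max_eq_right, Real.zero_rpow (by positivity)]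
    · simp
    · rw [mem_Ioc, not_and_or, not_lt, not_le] at hu
      rcases hu with hu | hu <;> nlinarith

theorem fourierInv_ballPower_inv_smul {s : ℝ} (hs : 0 < s) (y : EuclideanSpace ℝ (Fin d)) :
    𝓕⁻ (fun η : EuclideanSpace ℝ (Fin d) => (ballPower lam (s⁻¹ • η) : ℂ)) y
      = (s : ℂ) ^ d * 𝓕⁻ (fun η : EuclideanSpace ℝ (Fin d) => (ballPower lam η : ℂ)) (s • y) := by
  simp only [Real.fourierInv_eq]
  have h : ∀ η : EuclideanSpace ℝ (Fin d), inner ℝ η y = inner ℝ (s⁻¹ • η) (s • y) := fun η => by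
    rw [real_inner_smul_left, real_inner_smul_right, ← mul_assoc, inv_mul_cancel₀ hs.ne', one_mul]
  simp_rw [h]
  rw [Measure.integral_comp_inv_smul_of_nonneg volume
    (fun η => fourierChar (inner ℝ η (s • y)) • (ballPower lam η : ℂ)) hs.le,
    finrank_euclideanSpace_fin, Complex.real_smul, Complex.ofReal_pow]

end BallPower

/-! ### The cone kernel as a one-dimensional integral. -/

section Kernel

variable {ψ : ℝ → ℝ} {lam : ℝ} {d : ℕ}

theorem IsDyadicBump.eq_zero (hψ : IsDyadicBump ψ) {s : ℝ} (hs : s < 1 / 4 ∨ 1 < s) : ψ s = 0 := by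
  by_contra h
  have := hψ.support_subset (subset_tsupport ψ h)
  rcases hs with hs | hs <;> linarith [this.1, this.2]

theorem IsDyadicBump.hasCompactSupport (hψ : IsDyadicBump ψ) : HasCompactSupport ψ :=
  isCompact_Icc.of_isClosed_subset (isClosed_tsupport ψ) hψ.support_subset

/-- For `v > 0` the section of the dilated cone is a ball of radius `t v`; for `v ≤ 0` the cutoff
kills both sides. -/
theorem symbol_eq (hψ : IsDyadicBump ψ) {t : ℝ} (η : EuclideanSpace ℝ (Fin d)) (v : ℝ) :
    symbol ψ lam (t⁻¹ • η) v = ballPower lam ((t * v)⁻¹ • η) * ψ (2⁻¹ * v) := by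
  rcases le_or_gt v 0 with h | h
  · rw [symbol, hψ.eq_zero (Or.inl (by linarith)), mul_zero, mul_zero]
  · rw [symbol, ballPower, mul_inv, mul_comm t⁻¹, mul_smul, norm_smul v⁻¹, norm_inv,
      Real.norm_of_nonneg h.le, mul_pow, inv_pow, div_eq_inv_mul]

theorem measurable_symbol (hψ : IsDyadicBump ψ) (t : ℝ) :
    Measurable fun z : EuclideanSpace ℝ (Fin d) × ℝ => symbol ψ lam (t⁻¹ • z.1) z.2 := by
  have := hψ.smooth.continuous.measurable
  unfold symbol
  fun_prop

/-- The cutoff forces `v ≤ 2`, so the horizontal support lies in the ball of radius `2 t`. -/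
theorem integrable_symbol (hψ : IsDyadicBump ψ) (hlam : 0 < lam) {t : ℝ} (ht : 0 < t) :
    Integrable fun z : EuclideanSpace ℝ (Fin d) × ℝ => symbol ψ lam (t⁻¹ • z.1) z.2 := by
  have h1 : Integrable ((Metric.closedBall (0 : EuclideanSpace ℝ (Fin d)) (2 * t)).indicator
      fun _ => (1 : ℝ)) :=
    (integrable_indicator_iff Metric.isClosed_closedBall.measurableSet).2
      (integrableOn_const measure_closedBall_lt_top.ne)
  have h2 : Integrable fun v : ℝ => ψ (2⁻¹ * v) :=
    (hψ.smooth.continuous.integrable_of_hasCompactSupport hψ.hasCompactSupport).comp_mul_left'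
      (by norm_num)
  refine (h1.mul_prod h2.norm).mono' (measurable_symbol hψ t).aestronglyMeasurable
    (Filter.Eventually.of_forall fun z => ?_)
  rw [symbol_eq hψ, norm_mul]
  by_cases hv : ψ (2⁻¹ * z.2) = 0
  · simp [hv]
  refine mul_le_mul_of_nonneg_right ?_ (norm_nonneg _)
  have hv1 : 1 / 4 ≤ 2⁻¹ * z.2 ∧ 2⁻¹ * z.2 ≤ 1 := by
    by_contra h
    rw [not_and_or, not_le, not_le] at h
    exact hv (hψ.eq_zero h)
  have htv : 0 < t * z.2 := mul_pos ht (by linarith)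
  rw [Real.norm_of_nonneg (ballPower_nonneg _)]
  by_cases hz : z.1 ∈ Metric.closedBall (0 : EuclideanSpace ℝ (Fin d)) (2 * t)
  · rw [indicator_of_mem hz]
    exact ballPower_le_one hlam _
  · rw [indicator_of_notMem hz, ballPower_eq_zero hlam]
    rw [mem_closedBall_zero_iff, not_le] at hz
    rw [norm_smul, norm_inv, Real.norm_of_nonneg htv.le, ← div_eq_inv_mul, le_div_iff₀ htv]
    nlinarith

theorem integrable_dilatedSymbol (hψ : IsDyadicBump ψ) (hlam : 0 < lam) {t : ℝ} (ht : 0 < t) :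
    Integrable fun ξ : Space d => (dilatedSymbol ψ lam t ξ : ℂ) := by
  have h := (measurePreserving_splitEquiv (d := d)).integrable_comp_of_integrable
    (integrable_symbol (lam := lam) hψ hlam ht)
  refine h.ofReal.congr (Filter.Eventually.of_forall fun ξ => ?_)
  simp only [Function.comp_apply, splitEquiv_apply]
  rfl

/-- The vertical profile `v ↦ ψ(v / 2) v^d`. -/
noncomputable def verticalProfile (ψ : ℝ → ℝ) (d : ℕ) (v : ℝ) : ℂ := (ψ (2⁻¹ * v) * v ^ d : ℝ)

theorem IsDyadicBump.hasCompactSupport_verticalProfile (hψ : IsDyadicBump ψ) (d : ℕ) :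
    HasCompactSupport (verticalProfile ψ d) := by
  refine HasCompactSupport.intro (isCompact_Icc (a := (0 : ℝ)) (b := 2)) fun v hv => ?_
  have : ψ (2⁻¹ * v) = 0 := by
    refine hψ.eq_zero ?_
    rw [mem_Icc, not_and_or, not_le, not_le] at hv
    exact hv.imp (fun h => by linarith) fun h => by linarith
  simp [verticalProfile, this]

/-- The slice at height `v` contributes `(t v)^(d+1)` and the phase `u t v ‖x'‖`. The power of `v`
goes into the vertical profile and the phases merge into `v (r u + x_n)`. Integrating in `v` before
`u` then produces the inverse transform of the profile at `r u + x_n`. -/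
theorem coneKernel_eq (hψ : IsDyadicBump ψ) (hlam : 0 < lam) {t : ℝ} (ht : 0 < t)
    (x : Space (d + 1)) :
    coneKernel ψ lam t x
      = (((∫ η : EuclideanSpace ℝ (Fin d), ballPower lam η) * t ^ (d + 1) : ℝ) : ℂ) *
        sphericalAverage 1 (lam + d / 2) (𝓕⁻ (verticalProfile ψ (d + 1))) (t * ‖horiz x‖)
          (vert x) := by
  set c := ∫ η : EuclideanSpace ℝ (Fin d), ballPower lam η
  set r := t * ‖horiz x‖
  set g := verticalProfile ψ (d + 1)
  have hψc : Continuous ψ := hψ.smooth.continuous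
  have hgc : Continuous g := by unfold g verticalProfile; fun_prop
  have hgi : Integrable g := hgc.integrable_of_hasCompactSupport
    (hψ.hasCompactSupport_verticalProfile (d + 1))
  set w : ℝ → ℂ := fun u => (((1 - u ^ 2) ^ (lam + d / 2) : ℝ) : ℂ)
  have hwc : Continuous w := Complex.continuous_ofReal.comp
    (Continuous.rpow_const (by fun_prop) fun _ => Or.inr (by positivity))
  have hslice : ∀ v : ℝ, fourierChar (v * vert x) •
      𝓕⁻ (fun η : EuclideanSpace ℝ (Fin (d + 1)) => (symbol ψ lam (t⁻¹ • η) v : ℂ)) (horiz x)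
      = ((c * t ^ (d + 1) : ℝ) : ℂ) *
        ∫ u in (-1 : ℝ)..1, w u * (fourierChar (v * (r * u + vert x)) • g v) := by
    intro v
    simp_rw [symbol_eq hψ]
    rcases le_or_gt v 0 with hv | hv
    · have h0 : ψ (2⁻¹ * v) = 0 := hψ.eq_zero (Or.inl (by linarith))
      simp [g, verticalProfile, h0, Real.fourierInv_eq]
    · have htv : 0 < t * v := mul_pos ht hv
      have e1 : 𝓕⁻ (fun η : EuclideanSpace ℝ (Fin (d + 1)) =>
          ((ballPower lam ((t * v)⁻¹ • η) * ψ (2⁻¹ * v) : ℝ) : ℂ)) (horiz x)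
          = (ψ (2⁻¹ * v) : ℂ) * 𝓕⁻ (fun η : EuclideanSpace ℝ (Fin (d + 1)) =>
            (ballPower lam ((t * v)⁻¹ • η) : ℂ)) (horiz x) := by
        simp only [Real.fourierInv_eq, ← integral_const_mul]
        refine integral_congr_ae (Filter.Eventually.of_forall fun η => ?_)
        simp only [Circle.smul_def, smul_eq_mul]
        push_cast
        ring
      rw [e1, fourierInv_ballPower_inv_smul htv, fourierInv_ballPower hlam, Circle.smul_def,
        smul_eq_mul]
      simp only [← intervalIntegral.integral_const_mul]
      refine intervalIntegral.integral_congr fun u _ => ?_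
      have e2 : v * (r * u + vert x) = v * vert x + u * ‖(t * v) • horiz x‖ := by
        rw [norm_smul, Real.norm_of_nonneg htv.le]
        ring
      simp only [e2, AddChar.map_add_eq_mul, Circle.smul_def, smul_eq_mul, Circle.coe_mul, g,
        verticalProfile, w]
      push_cast
      ring
  have hM := (integrable_symbol (d := d + 1) (lam := lam) hψ hlam ht).ofReal (𝕜 := ℂ)
  have h := fourierInv_comp_split hM x
  have hk : coneKernel ψ lam t x = 𝓕⁻ (fun ξ : Space (d + 1) =>
      (symbol ψ lam (t⁻¹ • horiz ξ) (vert ξ) : ℂ)) x := rfl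
  rw [hk]
  refine h.trans ?_
  refine (integral_congr_ae (Filter.Eventually.of_forall hslice)).trans ?_
  rw [integral_const_mul, ← intervalIntegral_integral_swap]
  · congr 1
    refine intervalIntegral.integral_congr fun u _ => ?_
    simp only [integral_const_mul, Real.fourierInv_eq, w, Polynomial.eval_one, one_mul]
    congr 1
    refine integral_congr_ae (Filter.Eventually.of_forall fun v => ?_)
    simp [mul_comm]
  · have hwi : Integrable w (volume.restrict (uIoc (-1) 1)) :=
      (hwc.intervalIntegrable (-1) 1).def'
    refine (hwi.mul_prod hgi).norm.mono' (Continuous.aestronglyMeasurable ?_)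
      (Filter.Eventually.of_forall fun z => by simp [Function.uncurry])
    unfold Function.uncurry
    fun_prop

theorem continuous_coneKernel (hψ : IsDyadicBump ψ) (hlam : 0 < lam) {t : ℝ} (ht : 0 < t) :
    Continuous (coneKernel ψ lam t : Space d → ℂ) := by
  have h := VectorFourier.fourierIntegral_continuous (L := innerₗ (Space d))
    Real.continuous_fourierChar continuous_inner (integrable_dilatedSymbol (d := d) hψ hlam ht)
  exact (h.comp continuous_neg).congr fun x => (Real.fourierInv_eq_fourier_neg _ x).symm

/-- On Schwartz functions, the cone means are convolutions with the cone kernel. -/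
theorem coneMean_eq_convolution (hψ : IsDyadicBump ψ) (hlam : 0 < lam) {t : ℝ} (ht : 0 < t)
    (f : 𝓢(Space d, ℂ)) (x : Space d) :
    coneMean ψ lam t f x
      = (coneKernel ψ lam t ⋆[ContinuousLinearMap.mul ℂ ℂ, volume] (f : Space d → ℂ)) x := by
  have hm := integrable_dilatedSymbol (d := d) hψ hlam ht
  set m : Space d → ℂ := fun ξ => (dilatedSymbol ψ lam t ξ : ℂ)
  have hg : Integrable fun ξ => fourierChar (inner ℝ ξ x) • m ξ := by
    refine hm.norm.mono' ?_ (Filter.Eventually.of_forall fun z => by simp)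
    exact (Continuous.aestronglyMeasurable (by fun_prop)).smul hm.aestronglyMeasurable
  -- The multiplication formula moves the transform from `f` to the modulated symbol, whose
  -- transform at `y` is the kernel at `x - y`.
  have key := VectorFourier.integral_bilin_fourierIntegral_eq_flip (ContinuousLinearMap.mul ℂ ℂ)
    (L := innerₗ (Space d)) Real.continuous_fourierChar continuous_inner (f.integrable (μ := volume)) hg
  have hK : ∀ y, coneKernel ψ lam t (x - y)
      = VectorFourier.fourierIntegral fourierChar volume (innerₗ (Space d)).flip
        (fun ξ => fourierChar (inner ℝ ξ x) • m ξ) y := by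
    intro y
    rw [coneKernel, Real.fourierInv_eq, VectorFourier.fourierIntegral]
    refine integral_congr_ae (Filter.Eventually.of_forall fun ξ => ?_)
    simp only [LinearMap.flip_apply, innerₗ_apply_apply, ← mul_smul, ← AddChar.map_add_eq_mul]
    congr 2
    rw [inner_sub_right, real_inner_comm ξ y]
    ring
  calc coneMean ψ lam t f x
      = ∫ ξ, ContinuousLinearMap.mul ℂ ℂ
          (VectorFourier.fourierIntegral fourierChar volume (innerₗ (Space d)) f ξ)
          (fourierChar (inner ℝ ξ x) • m ξ) := by
        rw [coneMean, Real.fourierInv_eq]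
        refine integral_congr_ae (Filter.Eventually.of_forall fun ξ => ?_)
        simp only [Circle.smul_def, smul_eq_mul, ContinuousLinearMap.mul_apply']
        change _ * (m ξ * VectorFourier.fourierIntegral fourierChar volume (innerₗ (Space d)) f ξ)
          = _
        ring
    _ = ∫ y, f y * coneKernel ψ lam t (x - y) := by
        rw [key]
        refine integral_congr_ae (Filter.Eventually.of_forall fun y => ?_)
        simp only [hK, ContinuousLinearMap.mul_apply']
    _ = ∫ y, coneKernel ψ lam t y * f (x - y) := by
        rw [← integral_sub_left_eq_self (fun y => coneKernel ψ lam t y * f (x - y)) volume x]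
        refine integral_congr_ae (Filter.Eventually.of_forall fun y => ?_)
        simp [mul_comm]
    _ = _ := rfl

end Kernel

end ConeMultiplier

namespace ConeMultiplier

/-! ### Schwartz primitives of the vertical profile and the kernel bound. -/

section Primitives

variable {ψ : ℝ → ℝ}

/-- The profile vanishes for `v < 1 / 2`, so dividing by powers of `v` creates no singularity. -/
theorem IsDyadicBump.contDiff_verticalProfile_div (hψ : IsDyadicBump ψ) (d k : ℕ) :
    ContDiff ℝ ∞ fun v : ℝ => verticalProfile ψ d v * ((2 * Real.pi * Complex.I * v : ℂ)⁻¹) ^ k := by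
  rw [contDiff_iff_contDiffAt]
  intro v
  rcases lt_or_ge v (1 / 2) with hv | hv
  · refine (contDiffAt_const (c := (0 : ℂ))).congr_of_eventuallyEq ?_
    filter_upwards [Iio_mem_nhds hv] with s hs
    rw [verticalProfile, hψ.eq_zero (Or.inl (by linarith [mem_Iio.1 hs])), zero_mul,
      Complex.ofReal_zero, zero_mul]
  · have hv0 : (2 * Real.pi * Complex.I * v : ℂ) ≠ 0 := by
      have : (v : ℂ) ≠ 0 := Complex.ofReal_ne_zero.2 (by linarith)
      simp [Real.pi_ne_zero, this]
    have h1 : ContDiff ℝ ∞ fun v : ℝ => (v : ℂ) := Complex.ofRealCLM.contDiff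
    have h2 : ContDiff ℝ ∞ fun v : ℝ => (verticalProfile ψ d v) :=
      Complex.ofRealCLM.contDiff.comp
        ((hψ.smooth.comp (contDiff_const.mul contDiff_id)).mul (contDiff_id.pow d))
    exact h2.contDiffAt.mul (((contDiff_const.mul h1).contDiffAt.inv hv0).pow k)

/-- The `k`-th primitive of the inverse Fourier transform of the vertical profile. -/
noncomputable def verticalPrimitive (hψ : IsDyadicBump ψ) (d k : ℕ) : 𝓢(ℝ, ℂ) :=
  𝓕⁻ ((hψ.hasCompactSupport_verticalProfile d).mul_right.toSchwartzMap
    (hψ.contDiff_verticalProfile_div d k))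

theorem verticalPrimitive_apply (hψ : IsDyadicBump ψ) (d k : ℕ) :
    (verticalPrimitive hψ d k : ℝ → ℂ)
      = 𝓕⁻ fun v : ℝ => verticalProfile ψ d v * ((2 * Real.pi * Complex.I * v : ℂ)⁻¹) ^ k := by
  rw [verticalPrimitive, SchwartzMap.fourierInv_coe]
  rfl

theorem verticalPrimitive_zero (hψ : IsDyadicBump ψ) (d : ℕ) :
    (verticalPrimitive hψ d 0 : ℝ → ℂ) = 𝓕⁻ (verticalProfile ψ d) := by
  rw [verticalPrimitive_apply]
  simp only [pow_zero, mul_one]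

/-- Differentiation multiplies by `2πiv` on the Fourier side and cancels one inverse factor; at `v =
0` the profile is zero. -/
theorem hasDerivAt_verticalPrimitive (hψ : IsDyadicBump ψ) (d k : ℕ) (s : ℝ) :
    HasDerivAt (verticalPrimitive hψ d (k + 1)) (verticalPrimitive hψ d k s) s := by
  rw [verticalPrimitive_apply, verticalPrimitive_apply, Real.fourierInv_eq_fourier_comp_neg,
    Real.fourierInv_eq_fourier_comp_neg]
  set g : ℕ → ℝ → ℂ := fun k v =>
    verticalProfile ψ d v * ((2 * Real.pi * Complex.I * v : ℂ)⁻¹) ^ k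
  have hg : ∀ k, Integrable (g k) := fun k =>
    (hψ.contDiff_verticalProfile_div d k).continuous.integrable_of_hasCompactSupport
      (hψ.hasCompactSupport_verticalProfile d).mul_right
  have hstep : ∀ v : ℝ, (2 * Real.pi * Complex.I * v : ℂ) * g (k + 1) v = g k v := by
    intro v
    rcases eq_or_ne v 0 with rfl | hv
    · have : ψ 0 = 0 := hψ.eq_zero (Or.inl (by norm_num))
      simp [g, verticalProfile, this]
    · have hv0 : (2 * Real.pi * Complex.I * v : ℂ) ≠ 0 := by
        simp [Real.pi_ne_zero, hv]
      simp only [g, pow_succ]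
      rw [mul_comm, mul_assoc, mul_assoc, inv_mul_cancel₀ hv0, mul_one]
  have hmul : (fun x : ℝ => (-2 * Real.pi * Complex.I * x : ℂ) • g (k + 1) (-x))
      = fun x => g k (-x) := by
    ext x
    rw [← hstep (-x), smul_eq_mul]
    push_cast
    ring
  have hint : Integrable fun x : ℝ => x • g (k + 1) (-x) := by
    have h := ((hg k).comp_neg).const_mul (-2 * Real.pi * Complex.I : ℂ)⁻¹
    refine h.congr (Filter.Eventually.of_forall fun x => ?_)
    have hc : (-2 * Real.pi * Complex.I : ℂ) ≠ 0 := by simp [Real.pi_ne_zero]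
    have := congrFun hmul x
    simp only [← this, smul_eq_mul, Complex.real_smul]
    rw [mul_assoc (-2 * Real.pi * Complex.I : ℂ), ← mul_assoc, inv_mul_cancel₀ hc, one_mul]
  have h := Real.hasDerivAt_fourier (hg (k + 1)).comp_neg hint s
  rw [hmul] at h
  exact h

theorem exists_norm_coneKernel_le (hψ : IsDyadicBump ψ) {lam : ℝ} {d : ℕ}
    (hlam : ((d : ℝ) + 2) / 2 < lam) :
    ∃ C β γ : ℝ, 0 ≤ C ∧ (d : ℝ) + 1 < β ∧ 1 < γ ∧ ∀ t, 0 < t → ∀ x : Space (d + 1),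
      ‖coneKernel ψ lam t x‖
        ≤ C * (t ^ (d + 1) * (1 + t * ‖horiz x‖) ^ (-β)) * (1 + |vert x|) ^ (-γ) := by
  have hd : (0 : ℝ) ≤ d := Nat.cast_nonneg d
  have hlam0 : 0 < lam := by linarith
  -- With `a = λ + d / 2`, the available decay `a + 1` exceeds the required `(d + 1) + 1` by `2δ`,
  -- which is shared equally between `β` and `γ`.
  set δ := (lam - (d + 2) / 2) / 2
  have hδ : 0 < δ := by simp only [δ]; linarith
  set c := ∫ η : EuclideanSpace ℝ (Fin d), ballPower lam η
  have hc : 0 ≤ c := integral_nonneg ballPower_nonneg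
  obtain ⟨C, hC0, hC⟩ := exists_norm_sphericalAverage_le_mul (verticalPrimitive hψ (d + 1))
    (hasDerivAt_verticalPrimitive hψ (d + 1)) (a := lam + d / 2) (β := d + 1 + δ) (γ := 1 + δ)
    (by positivity) (by positivity) (by positivity) (by simp only [δ]; linarith)
  refine ⟨c * C, d + 1 + δ, 1 + δ, by positivity, by linarith, by linarith, fun t ht x => ?_⟩
  rw [coneKernel_eq hψ hlam0 ht, norm_mul, Complex.norm_real,
    Real.norm_of_nonneg (by positivity), ← verticalPrimitive_zero hψ]
  calc c * t ^ (d + 1) * _ ≤ c * t ^ (d + 1) *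
        (C * ((1 + t * ‖horiz x‖) ^ (-((d : ℝ) + 1 + δ)) * (1 + |vert x|) ^ (-(1 + δ)))) := by
        gcongr
        exact hC _ (by positivity) _
    _ = _ := by ring

end Primitives

/-! ### Convolution bounds and passage to `L^p`. -/

section Convolution

variable {d : ℕ}

theorem integrable_dilate_mul {β γ t : ℝ} (hβ : (d : ℝ) < β) (hγ : 1 < γ) (ht : 0 < t) :
    Integrable fun x : Space d => (1 + t * ‖horiz x‖) ^ (-β) * (1 + |vert x|) ^ (-γ) := by
  have h1 : Integrable fun y : EuclideanSpace ℝ (Fin d) => (1 + t * ‖y‖) ^ (-β) := by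
    have h := (integrable_one_add_norm (μ := (volume : Measure (EuclideanSpace ℝ (Fin d))))
      (r := β) (by simpa using hβ)).comp_smul ht.ne'
    simpa only [norm_smul, Real.norm_of_nonneg ht.le] using h
  have h2 : Integrable fun v : ℝ => (1 + |v|) ^ (-γ) := by
    simpa using integrable_one_add_norm (μ := (volume : Measure ℝ)) (r := γ) (by simpa using hγ)
  have h := (measurePreserving_splitEquiv (d := d)).integrable_comp_of_integrable (h1.mul_prod h2)
  simpa only [Function.comp_def, splitEquiv_apply] using h

/-- Where `|f| ≤ 1` the integrand is at most `|K|`, and elsewhere at most `A |f|^p`. Both are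
integrable for every `x`, not merely almost every one. -/
theorem convolutionExists_of_integrable_of_memLp {K f : Space d → ℂ} {A : ℝ} (hK : Integrable K)
    (hA : ∀ x, ‖K x‖ ≤ A) {p : ℝ≥0∞} (hp : 1 ≤ p) (hp' : p ≠ ⊤) (hf : MemLp f p volume) :
    ConvolutionExists K f (ContinuousLinearMap.mul ℂ ℂ) volume := by
  intro x
  have hA0 : 0 ≤ A := (norm_nonneg _).trans (hA 0)
  have hp1 : 1 ≤ p.toReal := by simpa using (ENNReal.toReal_le_toReal ENNReal.one_ne_top hp').2 hp
  have hfp : Integrable fun y => ‖f y‖ ^ p.toReal :=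
    hf.integrable_norm_rpow (by positivity) hp'
  refine (hK.norm.add ((hfp.comp_sub_left x).const_mul A)).mono' ?_
    (Filter.Eventually.of_forall fun y => ?_)
  · exact hK.aestronglyMeasurable.mul (hf.aestronglyMeasurable.comp_quasiMeasurePreserving
      (quasiMeasurePreserving_sub_left volume x))
  · simp only [ContinuousLinearMap.mul_apply', norm_mul, Pi.add_apply]
    set a := ‖f (x - y)‖
    have ha : 0 ≤ a := norm_nonneg _
    have hKy := norm_nonneg (K y)
    have hap : 0 ≤ a ^ p.toReal := by positivity
    rcases le_total a 1 with h | h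
    · have := mul_le_of_le_one_right hKy h
      have := mul_nonneg hA0 hap
      linarith
    · have h1 : a ≤ a ^ p.toReal := by
        simpa using Real.rpow_le_rpow_of_exponent_le h hp1
      have := mul_le_mul (hA y) h1 ha hA0
      linarith

theorem enorm_convolution_le {K f : Space d → ℂ} {φ : Space d → ℝ≥0∞}
    (hφ : (fun y => ‖f y‖ₑ) =ᵐ[volume] φ) (x : Space d) :
    ‖(K ⋆[ContinuousLinearMap.mul ℂ ℂ, volume] f) x‖ₑ ≤ ∫⁻ y, ‖K y‖ₑ * φ (x - y) := by
  refine (enorm_integral_le_lintegral_enorm _).trans_eq ?_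
  refine lintegral_congr_ae ?_
  filter_upwards [(quasiMeasurePreserving_sub_left volume x).ae hφ] with y hy
  rw [ContinuousLinearMap.mul_apply', enorm_mul, hy]

theorem lintegral_comp_splitEquiv (F : EuclideanSpace ℝ (Fin d) × ℝ → ℝ≥0∞) :
    ∫⁻ x, F (splitEquiv d x) = ∫⁻ z, F z :=
  measurePreserving_splitEquiv.lintegral_comp_emb (splitEquiv d).measurableEmbedding F

theorem splitEquiv_sub (x y : Space d) :
    splitEquiv d (x - y) = splitEquiv d x - splitEquiv d y := by
  simp only [splitEquiv_apply]
  rfl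

/-- The vertical weight does not involve `t` and becomes the density of the finite measure `ν`. The
parameter `t` enters only as a dilation of the horizontal weight, which the maximal function
absorbs, so `D` and `ν` are uniform in `t`. -/
theorem exists_enorm_convolution_le_partialMaximal {C β γ : ℝ} (hC : 0 ≤ C) (hβ : (d : ℝ) < β)
    (hγ : 1 < γ) :
    ∃ (D : ℝ≥0) (ν : Measure ℝ), IsFiniteMeasure ν ∧ ∀ (K f : Space d → ℂ) (φ : Space d → ℝ≥0∞)
      (t : ℝ), 0 < t →
      (∀ x, ‖K x‖ ≤ C * (t ^ d * (1 + t * ‖horiz x‖) ^ (-β)) * (1 + |vert x|) ^ (-γ)) →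
      Measurable φ → (fun y => ‖f y‖ₑ) =ᵐ[volume] φ → ∀ x,
      ‖(K ⋆[ContinuousLinearMap.mul ℂ ℂ, volume] f) x‖ₑ
        ≤ D * partialMaximal volume ν (fun z => φ ((splitEquiv d).symm z)) (splitEquiv d x) := by
  set w : ℝ → ℝ≥0∞ := fun v => ENNReal.ofReal ((1 + |v|) ^ (-γ))
  have hw : Measurable w := by fun_prop
  set ν : Measure ℝ := volume.withDensity w
  have hν : IsFiniteMeasure ν := by
    have h := (integrable_one_add_norm (μ := (volume : Measure ℝ)) (r := γ) (by simpa using hγ))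
    refine isFiniteMeasure_withDensity_ofReal (f := fun v : ℝ => (1 + |v|) ^ (-γ)) ?_
    simpa using h.2
  obtain ⟨D, hD⟩ := exists_lintegral_le_partialMaximal
    (volume : Measure (EuclideanSpace ℝ (Fin d))) ν (β := β) (by simpa using hβ)
  rw [finrank_euclideanSpace_fin] at hD
  refine ⟨C.toNNReal * D, ν, hν, fun K f φ t ht hK hφ hfφ x => ?_⟩
  set φ' : EuclideanSpace ℝ (Fin d) × ℝ → ℝ≥0∞ := fun z => φ ((splitEquiv d).symm z)
  have hφ' : Measurable φ' := hφ.comp (splitEquiv d).symm.measurable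
  have hφx : ∀ y, φ y = φ' (splitEquiv d y) := fun y => by simp [φ']
  set k : EuclideanSpace ℝ (Fin d) → ℝ≥0∞ := fun y =>
    ENNReal.ofReal (t ^ d * (1 + t * ‖y‖) ^ (-β))
  have hk : Measurable k := by fun_prop
  calc _ ≤ ∫⁻ y, ‖K y‖ₑ * φ (x - y) := enorm_convolution_le hfφ x
    _ ≤ ∫⁻ y, (fun z : EuclideanSpace ℝ (Fin d) × ℝ =>
          ENNReal.ofReal C * (k z.1 * (w z.2 * φ' (splitEquiv d x - z)))) (splitEquiv d y) := by
        refine lintegral_mono fun y => ?_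
        simp only [hφx, splitEquiv_sub]
        rw [← mul_assoc, ← mul_assoc]
        refine mul_le_mul_left ?_ _
        rw [← ofReal_norm]
        refine (ENNReal.ofReal_le_ofReal (hK y)).trans_eq ?_
        rw [ENNReal.ofReal_mul (by positivity), ENNReal.ofReal_mul hC, splitEquiv_apply]
    _ = ∫⁻ z : EuclideanSpace ℝ (Fin d) × ℝ,
          ENNReal.ofReal C * (k z.1 * (w z.2 * φ' (splitEquiv d x - z))) :=
        lintegral_comp_splitEquiv (fun z : EuclideanSpace ℝ (Fin d) × ℝ =>
          ENNReal.ofReal C * (k z.1 * (w z.2 * φ' (splitEquiv d x - z))))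
    _ = ENNReal.ofReal C * ∫⁻ y, k y * ∫⁻ v, φ' ((splitEquiv d x).1 - y, (splitEquiv d x).2 - v)
          ∂ν := by
        rw [lintegral_const_mul' _ _ ENNReal.ofReal_ne_top, Measure.volume_eq_prod,
          lintegral_prod]
        · congr 1
          refine lintegral_congr fun y => ?_
          have hm : Measurable fun v : ℝ =>
              φ' ((splitEquiv d x).1 - y, (splitEquiv d x).2 - v) := hφ'.comp (by fun_prop)
          simp only
          rw [lintegral_const_mul' _ _ ENNReal.ofReal_ne_top,
            lintegral_withDensity_eq_lintegral_mul _ hw hm]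
          rfl
        · exact ((hk.comp measurable_fst).mul ((hw.comp measurable_snd).mul
            (hφ'.comp (measurable_const.sub measurable_id)))).aemeasurable
    _ ≤ ENNReal.ofReal C * (D * partialMaximal volume ν φ' (splitEquiv d x)) := by
        gcongr
        exact hD φ' hφ' t ht _
    _ = _ := by rw [ENNReal.coe_mul, mul_assoc]; rfl

/-- `F` will be a supremum over uncountably many `t`. Pointwise domination by a measurable function
bounds its norm without any measurability of `F`. -/
theorem eLpNorm_le_of_le_partialMaximal (ν : Measure ℝ) [IsFiniteMeasure ν] {p : ℝ≥0∞}
    (hp1 : 1 < p) (hp2 : p < ⊤) (D : ℝ≥0) :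
    ∃ C : ℝ≥0, ∀ (F : Space d → ℝ≥0∞) (f : Space d → ℂ) (φ : Space d → ℝ≥0∞), Measurable φ →
      (fun y => ‖f y‖ₑ) =ᵐ[volume] φ →
      (∀ x, F x ≤ D * partialMaximal volume ν (fun z => φ ((splitEquiv d).symm z))
        (splitEquiv d x)) →
      eLpNorm F p volume ≤ C * eLpNorm f p volume := by
  have hp0 : p ≠ 0 := (zero_lt_one.trans hp1).ne'
  have hr : 1 < p.toReal := by
    simpa using (ENNReal.toReal_lt_toReal ENNReal.one_ne_top hp2.ne).2 hp1
  have hr0 : 0 < p.toReal := by linarith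
  obtain ⟨A, hA⟩ := exists_lintegral_partialMaximal_rpow_le
    (volume : Measure (EuclideanSpace ℝ (Fin d))) ν hr
  refine ⟨D * A ^ (1 / p.toReal), fun F f φ hφ hfφ hF => ?_⟩
  set φ' : EuclideanSpace ℝ (Fin d) × ℝ → ℝ≥0∞ := fun z => φ ((splitEquiv d).symm z)
  have hφ' : Measurable φ' := hφ.comp (splitEquiv d).symm.measurable
  rw [eLpNorm_eq_lintegral_rpow_enorm_toReal hp0 hp2.ne,
    eLpNorm_eq_lintegral_rpow_enorm_toReal hp0 hp2.ne]
  have hfin : ∫⁻ x, ‖f x‖ₑ ^ p.toReal = ∫⁻ z, φ' z ^ p.toReal := by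
    rw [← lintegral_comp_splitEquiv]
    refine lintegral_congr_ae ?_
    filter_upwards [hfφ] with x hx
    rw [hx]
    simp [φ']
  have hle : ∫⁻ x, ‖F x‖ₑ ^ p.toReal
      ≤ (D : ℝ≥0∞) ^ p.toReal * (A * ∫⁻ x, ‖f x‖ₑ ^ p.toReal) := by
    calc ∫⁻ x, ‖F x‖ₑ ^ p.toReal
        ≤ ∫⁻ x, (fun z => (D : ℝ≥0∞) ^ p.toReal * partialMaximal volume ν φ' z ^ p.toReal)
            (splitEquiv d x) := by
          refine lintegral_mono fun x => ?_
          simp only [enorm_eq_self]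
          rw [← ENNReal.mul_rpow_of_nonneg _ _ hr0.le]
          gcongr
          exact hF x
      _ = (D : ℝ≥0∞) ^ p.toReal * ∫⁻ z, partialMaximal volume ν φ' z ^ p.toReal :=
          (lintegral_comp_splitEquiv (fun z : EuclideanSpace ℝ (Fin d) × ℝ =>
            (D : ℝ≥0∞) ^ p.toReal * partialMaximal volume ν φ' z ^ p.toReal)).trans
            (lintegral_const_mul' _ _ (ENNReal.rpow_ne_top_of_nonneg hr0.le ENNReal.coe_ne_top))
      _ ≤ _ := by
          rw [hfin]
          gcongr
          exact hA φ' hφ'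
  calc _ ≤ ((D : ℝ≥0∞) ^ p.toReal * (A * ∫⁻ x, ‖f x‖ₑ ^ p.toReal)) ^ (1 / p.toReal) := by gcongr
    _ = _ := by
      have hi : 0 ≤ 1 / p.toReal := by positivity
      rw [ENNReal.mul_rpow_of_nonneg _ _ hi, ENNReal.mul_rpow_of_nonneg _ _ hi, ← ENNReal.rpow_mul,
        mul_one_div_cancel hr0.ne', ENNReal.rpow_one, ENNReal.coe_mul,
        ENNReal.coe_rpow_of_nonneg _ hi, mul_assoc]

end Convolution

end ConeMultiplier

/-! ### The maximal theorem. -/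

theorem propositiont085 (d : ℕ) (hd : 1 ≤ d) (ψ : ℝ → ℝ) (hψ : ConeMultiplier.IsDyadicBump ψ)
    (lam : ℝ) (hlam : ((d + 1 : ℕ) : ℝ) / 2 < lam)
    (p : ℝ≥0∞) (hp1 : 1 < p) (hp2 : p < ⊤) :
    ∃ C : ℝ≥0,
      (∀ f : 𝓢(ConeMultiplier.Space d, ℂ),
        eLpNorm (ConeMultiplier.coneMaximal ψ lam f) p volume
          ≤ C * eLpNorm (f : ConeMultiplier.Space d → ℂ) p volume) ∧
      (∀ f : ConeMultiplier.Space d → ℂ, MemLp f p volume →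
        (∀ t : ℝ, 0 < t →
          ConvolutionExists (ConeMultiplier.coneKernel ψ lam t) f
            (ContinuousLinearMap.mul ℂ ℂ) volume) ∧
        eLpNorm (ConeMultiplier.coneMaximalConv ψ lam f) p volume
          ≤ C * eLpNorm f p volume) := by
  open ConeMultiplier in
  -- The horizontal space must have positive dimension, since one of its coordinates is split off to
  -- compute the transform of the ball profile.
  obtain ⟨k, rfl⟩ : ∃ k, d = k + 1 := ⟨d - 1, by omega⟩
  have hlam' : ((k : ℝ) + 2) / 2 < lam := by push_cast at hlam; linarith
  have hlam0 : 0 < lam := lt_of_le_of_lt (by positivity) hlam'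
  obtain ⟨A, β, γ, hA, hβ, hγ, hK⟩ := exists_norm_coneKernel_le hψ hlam'
  have hβ' : ((k + 1 : ℕ) : ℝ) < β := by push_cast; exact hβ
  obtain ⟨D, ν, hν, hD⟩ := exists_enorm_convolution_le_partialMaximal hA hβ' hγ
  obtain ⟨C, hC⟩ := eLpNorm_le_of_le_partialMaximal (d := k + 1) ν hp1 hp2 D
  have main : ∀ f : Space (k + 1) → ℂ, MemLp f p volume →
      (∀ t : ℝ, 0 < t →
        ConvolutionExists (coneKernel ψ lam t) f (ContinuousLinearMap.mul ℂ ℂ) volume) ∧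
      eLpNorm (coneMaximalConv ψ lam f) p volume ≤ C * eLpNorm f p volume := by
    intro f hf
    refine ⟨fun t ht => ?_, ?_⟩
    · refine convolutionExists_of_integrable_of_memLp (A := A * t ^ (k + 1)) ?_ (fun x => ?_)
        hp1.le hp2.ne hf
      · refine ((integrable_dilate_mul hβ' hγ ht).const_mul (A * t ^ (k + 1))).mono'
          (continuous_coneKernel hψ hlam0 ht).aestronglyMeasurable
          (Filter.Eventually.of_forall fun x => (hK t ht x).trans_eq (by ring))
      · have h1 : (1 + t * ‖horiz x‖) ^ (-β) ≤ 1 :=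
          Real.rpow_le_one_of_one_le_of_nonpos (le_add_of_nonneg_right (by positivity))
            (by linarith [Nat.cast_nonneg (α := ℝ) k])
        have h2 : (1 + |vert x|) ^ (-γ) ≤ 1 :=
          Real.rpow_le_one_of_one_le_of_nonpos (le_add_of_nonneg_right (by positivity))
            (by linarith)
        calc _ ≤ _ := hK t ht x
          _ ≤ A * (t ^ (k + 1) * 1) * 1 := by gcongr
          _ = _ := by ring
    -- A measurable representative of `f` feeds the maximal function; the convolutions do not see
    -- the change.
    · obtain ⟨f₀, hf₀, hff₀⟩ := hf.aestronglyMeasurable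
      have hφ : Measurable fun y => ‖f₀ y‖ₑ := hf₀.enorm
      have hfφ : (fun y => ‖f y‖ₑ) =ᵐ[volume] fun y => ‖f₀ y‖ₑ := by
        filter_upwards [hff₀] with y hy
        rw [hy]
      exact hC _ f _ hφ hfφ fun x => iSup₂_le fun t ht =>
        hD _ f _ t ht (hK t ht) hφ hfφ x
  refine ⟨C, fun f => ?_, main⟩
  have hmax : coneMaximal ψ lam f = coneMaximalConv ψ lam (f : Space (k + 1) → ℂ) := by
    ext x
    exact iSup_congr fun t => iSup_congr fun ht => by
      rw [coneMean_eq_convolution hψ hlam0 ht]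
  rw [hmax]
  exact (main f (f.memLp p volume)).2
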